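/- Let $M$ be a compact smooth $n$-dimensional Riemannian manifold (without boundary) with metric $g$. For $p\in M$ and $\eta\in T_pM$ let $t\mapsto p(t,\eta)$ be the geodesic through $p$ with tangent vector $\eta$ at $p$. For every $p\in M$ let $\mu_p$ be a (positive) Borel measure on $T_pM$ such that 1. $\sup_{p\in M}\sup_{\eta\in\operatorname{supp}\mu_p}\|\eta\|<\infty$; 2. $\sup_{p\in M}\mu_p(T_pM)<\infty$; 3. for every $p\in M$ and every smooth coordinate system around $p$, with $\eta=\sum_i\eta^i\partial_i$ and $(g^{ij})=(g_{ij})^{-1}$, one has $\int\eta^i\,\mu_p(d\eta)=0$ and $\int\eta^i\eta^j\,\mu_p(d\eta)=g^{ij}(p)$ for all $i,j$. For $N\in\mathbb{N}$ put $$L_Nf(p)=\int_{T_pM}\bigl(f(p(1/N,\eta))-f(p)\bigr)\,\mu_p(d\eta).$$ Then for every $f\in C^\infty(M)$ the integrals defining $L_Nf(p)$, $p\in M$, exist for all sufficiently large $N$, and $$N^2L_Nf\longrightarrow\tfrac12\Delta_Mf\quad\text{uniformly on }M\text{ as }N\to\infty,$$ where $\Delta_M$ is the Laplace-Beltrami operator,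 in local coordinates $\Delta_Mf=\sum_{i,j}g^{ij}\bigl(\partial_i\partial_jf-\sum_k\Gamma^k_{ij}\partial_kf\bigr)$ with $\Gamma^k_{ij}$ the Christoffel symbols of $g$. -/

import Mathlib

open MeasureTheory Filter Topology Set
open scoped Manifold ContDiff

noncomputable section

namespace GeodesicWalk

/-- Tangent spaces carry their Borel sigma-algebra. -/
instance instMeasurableSpaceTangent {n : ℕ} {M : Type*} [TopologicalSpace M]
    [ChartedSpace (EuclideanSpace ℝ (Fin n)) M] (p : M) :
    MeasurableSpace (TangentSpace (𝓡 n) p) :=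
  borel _

instance instBorelSpaceTangent {n : ℕ} {M : Type*} [TopologicalSpace M]
    [ChartedSpace (EuclideanSpace ℝ (Fin n)) M] (p : M) :
    BorelSpace (TangentSpace (𝓡 n) p) :=
  ⟨rfl⟩

/-- A smooth Riemannian metric on an `n`-dimensional manifold (without boundary). -/
abbrev Metric (n : ℕ) (M : Type*) [TopologicalSpace M]
    [ChartedSpace (EuclideanSpace ℝ (Fin n)) M] [IsManifold (𝓡 n) ∞ M] :=
  Bundle.ContMDiffRiemannianMetric (𝓡 n) ∞ (EuclideanSpace ℝ (Fin n))
    (fun x : M => TangentSpace (𝓡 n) x)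

/-- The smooth coordinate systems of `M`. -/
abbrev charts (n : ℕ) (M : Type*) [TopologicalSpace M]
    [ChartedSpace (EuclideanSpace ℝ (Fin n)) M] :
    Set (OpenPartialHomeomorph M (EuclideanSpace ℝ (Fin n))) :=
  IsManifold.maximalAtlas (𝓡 n) ∞ M

/-- The `i`-th standard partial derivative of a function on Euclidean space. -/
def partialDeriv {n : ℕ} (i : Fin n) (h : EuclideanSpace ℝ (Fin n) → ℝ)
    (y : EuclideanSpace ℝ (Fin n)) : ℝ :=
  fderiv ℝ h y (EuclideanSpace.single i 1)

variable {n : ℕ} {M : Type*} [TopologicalSpace M]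
  [ChartedSpace (EuclideanSpace ℝ (Fin n)) M]

/-- The component `η^i` of a tangent vector `η` at `p` in the coordinate system `φ` around `p`,
so that `η = ∑ i, η^i ∂_i`. -/
def component (φ : OpenPartialHomeomorph M (EuclideanSpace ℝ (Fin n))) (p : M)
    (η : TangentSpace (𝓡 n) p) (i : Fin n) : ℝ :=
  (show EuclideanSpace ℝ (Fin n) from mfderiv (𝓡 n) (𝓡 n) φ p η) i

/-- The coordinate vector field `∂_i` of the coordinate system `φ`, at the point with
coordinates `y`. -/
def coordVector (φ : OpenPartialHomeomorph M (EuclideanSpace ℝ (Fin n)))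
    (y : EuclideanSpace ℝ (Fin n)) (i : Fin n) : TangentSpace (𝓡 n) (φ.symm y) :=
  mfderiv (𝓡 n) (𝓡 n) φ.symm y (EuclideanSpace.single i (1 : ℝ) : EuclideanSpace ℝ (Fin n))

variable [IsManifold (𝓡 n) ∞ M]

/-- The norm of a tangent vector with respect to the Riemannian metric. -/
def tangentNorm (g : Metric n M) (p : M) (η : TangentSpace (𝓡 n) p) : ℝ :=
  Real.sqrt (g.inner p η η)

/-- The matrix `g_{ij} = g(∂_i, ∂_j)` in the coordinate system `φ`, as a function of the
coordinates. -/
def metricMatrix (g : Metric n M) (φ : OpenPartialHomeomorph M (EuclideanSpace ℝ (Fin n)))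
    (y : EuclideanSpace ℝ (Fin n)) : Matrix (Fin n) (Fin n) ℝ :=
  Matrix.of fun i j => g.inner (φ.symm y) (coordVector φ y i) (coordVector φ y j)

/-- The inverse matrix `g^{ij}` in the coordinate system `φ`. -/
def inverseMetric (g : Metric n M) (φ : OpenPartialHomeomorph M (EuclideanSpace ℝ (Fin n)))
    (y : EuclideanSpace ℝ (Fin n)) : Matrix (Fin n) (Fin n) ℝ :=
  (metricMatrix g φ y)⁻¹

/-- The Christoffel symbol `Γ^k_{ij}` of the Levi-Civita connection in the coordinate
system `φ`. -/
def christoffel (g : Metric n M) (φ : OpenPartialHomeomorph M (EuclideanSpace ℝ (Fin n)))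
    (k i j : Fin n) (y : EuclideanSpace ℝ (Fin n)) : ℝ :=
  (1 / 2) * ∑ l, inverseMetric g φ y k l *
    (partialDeriv i (fun z => metricMatrix g φ z j l) y
      + partialDeriv j (fun z => metricMatrix g φ z i l) y
      - partialDeriv l (fun z => metricMatrix g φ z i j) y)

/-- `γ` is a geodesic on the open interval `s`: it is of class `C²` there and satisfies the
geodesic equations in every coordinate system. -/
def IsGeodesicOn (g : Metric n M) (γ : ℝ → M) (s : Set ℝ) : Prop :=
  ContMDiffOn 𝓘(ℝ, ℝ) (𝓡 n) 2 γ s ∧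
    ∀ φ ∈ charts n M, ∀ t ∈ s, γ t ∈ φ.source → ∀ k : Fin n,
      deriv (deriv fun τ => φ (γ τ) k) t
        + ∑ i, ∑ j, christoffel g φ k i j (φ (γ t))
            * deriv (fun τ => φ (γ τ) i) t * deriv (fun τ => φ (γ τ) j) t = 0

/-- The point `q` is reached at time `t` by a geodesic (defined on an open interval containing
`0` and `t`) that starts at time `0` at `p` with tangent vector `η`. -/
def ReachedByGeodesic (g : Metric n M) (p : M) (η : TangentSpace (𝓡 n) p) (t : ℝ) (q : M) :
    Prop :=
  ∃ (γ : ℝ → M) (a b : ℝ), 0 ∈ Ioo a b ∧ t ∈ Ioo a b ∧ IsGeodesicOn g γ (Ioo a b) ∧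
    tangentMap 𝓘(ℝ, ℝ) (𝓡 n) γ ⟨0, (1 : ℝ)⟩ = ⟨p, η⟩ ∧ γ t = q

open Classical in
/-- The point `p(t, η)`: the position at time `t` of the geodesic through `p` with tangent
vector `η` at `p` (and `p` itself if that geodesic is not defined up to time `t`, which does not
happen on a compact manifold). -/
def geodesicPoint (g : Metric n M) (p : M) (η : TangentSpace (𝓡 n) p) (t : ℝ) : M :=
  if h : ∃ q, ReachedByGeodesic g p η t q then h.choose else p

/-- The operator `L_N f(p) = ∫ (f(p(1/N, η)) - f(p)) μ_p(dη)`. -/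
def generator (g : Metric n M) (μ : ∀ p : M, Measure (TangentSpace (𝓡 n) p)) (N : ℕ)
    (f : M → ℝ) (p : M) : ℝ :=
  ∫ η, (f (geodesicPoint g p η (1 / (N : ℝ))) - f p) ∂(μ p)

/-- The expression `∑ g^{ij} (∂_i ∂_j f - ∑ Γ^k_{ij} ∂_k f)` at `p` in the coordinate
system `φ`. -/
def laplacianInChart (g : Metric n M) (φ : OpenPartialHomeomorph M (EuclideanSpace ℝ (Fin n)))
    (f : M → ℝ) (p : M) : ℝ :=
  ∑ i, ∑ j, inverseMetric g φ (φ p) i j *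
    (partialDeriv i (partialDeriv j (fun y => f (φ.symm y))) (φ p)
      - ∑ k, christoffel g φ k i j (φ p) * partialDeriv k (fun y => f (φ.symm y)) (φ p))

/-- The Laplace-Beltrami operator, computed at `p` in the preferred coordinate system around `p`
(the value is the same in every coordinate system around `p`). -/
def laplaceBeltrami (g : Metric n M) (f : M → ℝ) (p : M) : ℝ :=
  laplacianInChart g (chartAt (EuclideanSpace ℝ (Fin n)) p) f p

end GeodesicWalk

end

set_option linter.unusedSectionVars false

/-! Along a geodesic `γ` from `p` with velocity `η`, put `u t = f (γ t)`. Then `u' 0 = df(η)`, and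
since the geodesic equation makes the acceleration `-Γ(v, v)`, `u''` is the covariant Hessian
`D²F(v, v) - DF(Γ(v, v))`, where `F` is `f` read in a chart. Taylor's formula at `h = 1/N` gives `h
df(η) + (h²/2) Hess f(η, η) + O(h³)`. Integration against `μ p` removes the linear term by centering
and turns the Hessian into its trace against `g^{ij}`, the Laplacian. After multiplication by `N²`
the error is `O(1/N)`.

The error must be uniform in `p` and `η`. The geodesic flow in a chart starts from a neighbourhood
of zero velocity, and rescaling time extends it to all velocities of bounded norm
(`exists_uniform_geodesicFlow`). This yields the expansion near each point
(`exists_nhds_hasUniformExpansion`), and compactness makes it global (`hasUniformExpansion_univ`).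

Since geodesics satisfy their equation in every chart and `geodesicPoint` selects an arbitrary one,
two more facts are needed. The equation is independent of the chart, because it is the
Euler-Lagrange equation of the energy (`eulerLagrange_comp`, `christoffelVec_transition`). Geodesics
are unique (`IsGeodesicOn.eq_of_geodesicField`, `geodesicPoint_eq`). -/

namespace GeodesicWalk

/-! ### Taylor remainder and local flows. -/

/-- Second order Taylor expansion with a remainder controlled by the modulus of continuity of the
second derivative. -/
lemma abs_taylor_two_le {u u₁ u₂ : ℝ → ℝ} {C h : ℝ} (hh : 0 ≤ h) (hC : 0 ≤ C)
    (hu : ∀ t ∈ Icc 0 h, HasDerivAt u (u₁ t) t) (hu₁ : ∀ t ∈ Icc 0 h, HasDerivAt u₁ (u₂ t) t)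
    (hu₂ : ∀ t ∈ Icc 0 h, |u₂ t - u₂ 0| ≤ C * t) :
    |u h - u 0 - h * u₁ 0 - h ^ 2 / 2 * u₂ 0| ≤ C * h ^ 3 := by
  have h0 : (0 : ℝ) ∈ Icc 0 h := ⟨le_rfl, hh⟩
  have key : ∀ t ∈ Icc 0 h, |u₁ t - u₁ 0 - t * u₂ 0| ≤ C * h * h := by
    intro t ht
    -- The mean value inequality is used twice, each time bounding the derivative by a constant on
    -- all of `[0, h]`; this loses only the factor `1/6`.
    have := (convex_Icc 0 h).norm_image_sub_le_of_norm_hasDerivWithin_le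
      (f := fun t => u₁ t - t * u₂ 0) (f' := fun t => u₂ t - u₂ 0) (C := C * h)
      (fun s hs => by
        simpa using ((hu₁ s hs).fun_sub ((hasDerivAt_id s).mul_const (u₂ 0))).hasDerivWithinAt)
      (fun s hs => (hu₂ s hs).trans (by gcongr; exact hs.2)) h0 ht
    simp only [Real.norm_eq_abs, zero_mul, sub_zero] at this
    rw [abs_of_nonneg ht.1] at this
    calc |u₁ t - u₁ 0 - t * u₂ 0| = |u₁ t - t * u₂ 0 - u₁ 0| := by ring_nf
      _ ≤ C * h * t := this
      _ ≤ C * h * h := by gcongr; exact ht.2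
  have := (convex_Icc 0 h).norm_image_sub_le_of_norm_hasDerivWithin_le
    (f := fun t => u t - t * u₁ 0 - t ^ 2 / 2 * u₂ 0)
    (f' := fun t => u₁ t - u₁ 0 - t * u₂ 0) (C := C * h * h)
    (fun s hs => by
      have h2 : HasDerivAt (fun t : ℝ => t ^ 2 / 2 * u₂ 0) (s * u₂ 0) s := by
        have := (((hasDerivAt_id s).pow 2).div_const 2).mul_const (u₂ 0)
        simpa using this
      simpa using (((hu s hs).fun_sub ((hasDerivAt_id s).mul_const (u₁ 0))).fun_sub h2).hasDerivWithinAt)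
    key h0 ⟨hh, le_rfl⟩
  simp only [Real.norm_eq_abs, zero_mul, sub_zero] at this
  rw [abs_of_nonneg hh] at this
  calc _ = |u h - h * u₁ 0 - h ^ 2 / 2 * u₂ 0 - (u 0 - 0 ^ 2 / 2 * u₂ 0)| := by ring_nf
    _ ≤ _ := this
    _ = C * h ^ 3 := by ring

/-- The local flow of a `C¹` vector field near a point, with values in a given neighbourhood. -/
lemma exists_localFlow {V : Type*} [NormedAddCommGroup V] [NormedSpace ℝ V] [CompleteSpace V]
    {F : V → V} {z₀ : V} (hF : ContDiffAt ℝ 1 F z₀) {U : Set V} (hU : U ∈ 𝓝 z₀) :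
    ∃ r > (0 : ℝ), ∃ ε > (0 : ℝ), ∃ L ≥ (0 : ℝ), ∃ α : V → ℝ → V,
      (∀ z ∈ Metric.closedBall z₀ r, α z 0 = z ∧ ∀ t ∈ Ioo (-ε) ε,
        HasDerivAt (α z) (F (α z t)) t ∧ α z t ∈ U ∧ ‖α z t - z‖ ≤ L * |t|) ∧
      ∀ t ∈ Ioo (-ε) ε, ContinuousOn (fun z => α z t) (Metric.closedBall z₀ r) := by
  obtain ⟨ε, hε, a, r, L, K, hr, hpl⟩ := IsPicardLindelof.of_contDiffAt_one hF
  obtain ⟨α, hα, hcont⟩ :=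
    (hpl 0).exists_forall_mem_closedBall_eq_hasDerivWithinAt_continuousOn
  have hr' : (0 : ℝ) < r := hr
  -- Confining the flow to a set where `F` is bounded also bounds its speed, whence `L = ‖F z₀‖ +
  -- 1`.
  have hV : U ∩ {z | ‖F z‖ < ‖F z₀‖ + 1} ∈ 𝓝 z₀ :=
    inter_mem hU (hF.continuousAt.norm.eventually (gt_mem_nhds (by linarith)))
  have hc0 : ContinuousAt α (z₀, 0) := by
    refine hcont.continuousAt (prod_mem_nhds (Metric.closedBall_mem_nhds _ hr') ?_)
    exact Icc_mem_nhds (by simpa using hε) (by simpa using hε)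
  have hz₀ : α (z₀, 0) = z₀ := (hα z₀ (Metric.mem_closedBall_self hr'.le)).1
  have hpre : α ⁻¹' (U ∩ {z | ‖F z‖ < ‖F z₀‖ + 1}) ∈ 𝓝 (z₀, (0 : ℝ)) :=
    hc0.preimage_mem_nhds (by rwa [hz₀])
  obtain ⟨δ, hδ, hball⟩ := Metric.mem_nhds_iff.1 hpre
  have hsub : ∀ z ∈ Metric.closedBall z₀ (min r (δ / 2)), ∀ t ∈ Ioo (-(min ε δ)) (min ε δ),
      α (z, t) ∈ U ∩ {z | ‖F z‖ < ‖F z₀‖ + 1} := by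
    intro z hz t ht
    apply hball
    rw [Metric.mem_ball, Prod.dist_eq, max_lt_iff]
    have h1 := Metric.mem_closedBall.1 hz
    refine ⟨lt_of_le_of_lt (h1.trans (min_le_right _ _)) (by linarith), ?_⟩
    simp only [Real.dist_eq, sub_zero]
    exact (abs_lt.2 ht).trans_le (min_le_right _ _)
  have hzr : ∀ z ∈ Metric.closedBall z₀ (min (r : ℝ) (δ / 2)), z ∈ Metric.closedBall z₀ r :=
    fun z hz => Metric.closedBall_subset_closedBall (min_le_left _ _) hz
  have hder : ∀ z ∈ Metric.closedBall z₀ (min (r : ℝ) (δ / 2)),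
      ∀ t ∈ Ioo (-(min ε δ)) (min ε δ), HasDerivAt (fun t => α (z, t)) (F (α (z, t))) t := by
    intro z hz t ht
    have h1 : t ∈ Ioo (0 - ε) (0 + ε) := by
      simp only [zero_sub, zero_add]
      exact ⟨lt_of_le_of_lt (neg_le_neg (min_le_left _ _)) ht.1, ht.2.trans_le (min_le_left _ _)⟩
    exact ((hα z (hzr z hz)).2 t (Ioo_subset_Icc_self h1)).hasDerivAt (Icc_mem_nhds h1.1 h1.2)
  have hm0 : (0 : ℝ) ∈ Ioo (-(min ε δ)) (min ε δ) := by
    have : 0 < min ε δ := lt_min hε hδ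
    exact ⟨by linarith, this⟩
  refine ⟨min r (δ / 2), lt_min hr' (by positivity), min ε δ, lt_min hε hδ, ‖F z₀‖ + 1,
    by positivity, fun z t => α (z, t), fun z hz => ⟨(hα z (hzr z hz)).1, fun t ht =>
      ⟨hder z hz t ht, (hsub z hz t ht).1, ?_⟩⟩, fun t ht => ?_⟩
  · have := (convex_Ioo (-(min ε δ)) (min ε δ)).norm_image_sub_le_of_norm_hasDerivWithin_le
      (f := fun t => α (z, t)) (C := ‖F z₀‖ + 1)
      (fun s hs => (hder z hz s hs).hasDerivWithinAt)
      (fun s hs => le_of_lt (hsub z hz s hs).2) hm0 ht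
    simpa [(hα z (hzr z hz)).1] using this
  · refine hcont.comp (by fun_prop) fun z hz => ⟨hzr z hz, ?_⟩
    simp only [zero_sub, zero_add]
    exact ⟨(neg_le_neg (min_le_left _ _)).trans ht.1.le, ht.2.le.trans (min_le_left _ _)⟩

/-! ### Coordinate invariance of the Euler-Lagrange expression. -/

section EulerLagrange

variable {V : Type*} [NormedAddCommGroup V] [NormedSpace ℝ V]

/-- The Euler-Lagrange expression of the energy of a (position dependent) bilinear form `G`, at
position `x`, velocity `v` and acceleration `a`, in the direction `z`. -/
noncomputable def eulerLagrange (G : V → V →L[ℝ] V →L[ℝ] ℝ) (x v a z : V) : ℝ :=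
  G x a z + fderiv ℝ G x v v z - (1 / 2) * fderiv ℝ G x z v v

/-- The Euler-Lagrange expression is invariant under changes of coordinates. -/
lemma eulerLagrange_comp {G₁ G₂ : V → V →L[ℝ] V →L[ℝ] ℝ} {ψ : V → V} {x : V}
    (hψ : ContDiffAt ℝ 2 ψ x) (hG₂ : DifferentiableAt ℝ G₂ (ψ x)) (hG₁ : DifferentiableAt ℝ G₁ x)
    (hsymm : ∀ u w, G₂ (ψ x) u w = G₂ (ψ x) w u)
    (h : ∀ᶠ y in 𝓝 x, ∀ u w, G₁ y u w = G₂ (ψ y) (fderiv ℝ ψ y u) (fderiv ℝ ψ y w))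
    (v a z : V) :
    eulerLagrange G₁ x v a z = eulerLagrange G₂ (ψ x) (fderiv ℝ ψ x v)
      (fderiv ℝ ψ x a + fderiv ℝ (fderiv ℝ ψ) x v v) (fderiv ℝ ψ x z) := by
  have hψ1 : DifferentiableAt ℝ ψ x := hψ.differentiableAt (by norm_num)
  have hψ2 : DifferentiableAt ℝ (fderiv ℝ ψ) x :=
    (hψ.fderiv_right (m := 1) (by norm_num)).differentiableAt (by norm_num)
  have hsym2 : ∀ u w, fderiv ℝ (fderiv ℝ ψ) x u w = fderiv ℝ (fderiv ℝ ψ) x w u :=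
    fun u w => (hψ.isSymmSndFDerivAt (by simp)).eq u w
  have hD : ∀ d u w, fderiv ℝ G₁ x d u w =
      fderiv ℝ G₂ (ψ x) (fderiv ℝ ψ x d) (fderiv ℝ ψ x u) (fderiv ℝ ψ x w)
        + G₂ (ψ x) (fderiv ℝ (fderiv ℝ ψ) x d u) (fderiv ℝ ψ x w)
        + G₂ (ψ x) (fderiv ℝ ψ x u) (fderiv ℝ (fderiv ℝ ψ) x d w) := by
    intro d u w
    have h1 : HasFDerivAt (fun y => G₁ y u w) _ x :=
      (hG₁.hasFDerivAt.clm_apply (hasFDerivAt_const u x)).clm_apply (hasFDerivAt_const w x)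
    have h2 : HasFDerivAt (fun y => G₂ (ψ y) (fderiv ℝ ψ y u) (fderiv ℝ ψ y w)) _ x :=
      ((hG₂.hasFDerivAt.comp x hψ1.hasFDerivAt).clm_apply
        (hψ2.hasFDerivAt.clm_apply (hasFDerivAt_const u x))).clm_apply
        (hψ2.hasFDerivAt.clm_apply (hasFDerivAt_const w x))
    have h3 := h1.unique (h2.congr_of_eventuallyEq (h.mono fun y hy => hy u w))
    have h4 := congrArg (fun T : V →L[ℝ] ℝ => T d) h3
    simp at h4
    rw [h4]; ring
  unfold eulerLagrange
  rw [hD, hD, h.self_of_nhds]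
  -- By symmetry of `D²ψ` and `G₂`, the mixed terms `G₂(Dψ v, D²ψ(v, z))` cancel; the surviving
  -- `G₂(D²ψ(v, v), Dψ z)` joins the acceleration.
  rw [hsym2 z v, hsymm (fderiv ℝ (fderiv ℝ ψ) x v z), hsym2 v v]
  simp only [map_add, _root_.add_apply]
  ring

end EulerLagrange

end GeodesicWalk

/-! ### Smoothness of the metric coefficients in a chart. -/

namespace GeodesicWalk

section MatrixSmooth

variable {V ι : Type*} [NormedAddCommGroup V] [NormedSpace ℝ V] [Fintype ι] [DecidableEq ι]
  {m : WithTop ℕ∞} {s : Set V}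

lemma contDiffOn_det {A : V → Matrix ι ι ℝ} (hA : ∀ i j, ContDiffOn ℝ m (fun y => A y i j) s) :
    ContDiffOn ℝ m (fun y => (A y).det) s := by
  simp only [Matrix.det_apply']
  exact ContDiffOn.sum fun σ _ => contDiffOn_const.mul (contDiffOn_prod fun i _ => hA _ _)

/-- Cramer's rule: each entry is a determinant of a row-updated matrix divided by `det A`. -/
lemma contDiffOn_matrix_inv {A : V → Matrix ι ι ℝ}
    (hA : ∀ i j, ContDiffOn ℝ m (fun y => A y i j) s) (hdet : ∀ y ∈ s, (A y).det ≠ 0) (i j : ι) :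
    ContDiffOn ℝ m (fun y => (A y)⁻¹ i j) s := by
  simp only [Matrix.inv_def, Matrix.smul_apply, Matrix.adjugate_apply, smul_eq_mul,
    Ring.inverse_eq_inv']
  refine ((contDiffOn_det hA).inv hdet).mul (contDiffOn_det fun k l => ?_)
  simp only [Matrix.updateRow_apply]
  split_ifs with h
  · exact contDiffOn_const
  · exact hA k l

end MatrixSmooth

variable {n : ℕ} {M : Type*} [TopologicalSpace M]
  [ChartedSpace (EuclideanSpace ℝ (Fin n)) M] [IsManifold (𝓡 n) ∞ M]


lemma mdifferentiable_chart {φ : OpenPartialHomeomorph M (EuclideanSpace ℝ (Fin n))}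
    (hφ : φ ∈ charts n M) : φ.MDifferentiable (𝓡 n) (𝓡 n) :=
  ⟨(contMDiffOn_of_mem_maximalAtlas hφ).mdifferentiableOn (by simp),
    (contMDiffOn_symm_of_mem_maximalAtlas hφ).mdifferentiableOn (by simp)⟩

/-- The coordinate field is the image of a constant vector field under the tangent map of `φ.symm`.
-/
lemma contMDiffOn_coordVector {φ : OpenPartialHomeomorph M (EuclideanSpace ℝ (Fin n))}
    (hφ : φ ∈ charts n M) (i : Fin n) :
    ContMDiffOn (𝓡 n) ((𝓡 n).prod 𝓘(ℝ, EuclideanSpace ℝ (Fin n))) ∞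
      (fun y => (⟨φ.symm y, coordVector φ y i⟩ : TangentBundle (𝓡 n) M)) φ.target := by
  have h1 := (contMDiffOn_symm_of_mem_maximalAtlas hφ).contMDiffOn_tangentMapWithin
    (m := ∞) (by simp) φ.open_target.uniqueMDiffOn
  have h2 : ContMDiffOn (𝓡 n) ((𝓡 n).prod 𝓘(ℝ, EuclideanSpace ℝ (Fin n))) ∞
      (fun y => Bundle.TotalSpace.mk' (EuclideanSpace ℝ (Fin n)) y
        (show TangentSpace (𝓡 n) y from (EuclideanSpace.single i (1 : ℝ) :
          EuclideanSpace ℝ (Fin n)))) φ.target := by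
    exact fun y hy => contMDiffWithinAt_vectorSpace_iff_contDiffWithinAt.2 contDiffWithinAt_const
  refine (h1.comp h2 fun y hy => hy).congr fun y hy => ?_
  simp [tangentMapWithin, coordVector]
  rw [mfderivWithin_of_isOpen φ.open_target hy]

lemma contDiffOn_metricMatrix (g : Metric n M)
    {φ : OpenPartialHomeomorph M (EuclideanSpace ℝ (Fin n))} (hφ : φ ∈ charts n M) (i j : Fin n) :
    ContDiffOn ℝ ∞ (fun y => metricMatrix g φ y i j) φ.target := by
  have h := ContMDiffOn.clm_bundle_apply₂ (F₃ := ℝ) (E₃ := Bundle.Trivial M ℝ) 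
    (ψ := fun y => g.inner (φ.symm y))
    (g.contMDiff.comp_contMDiffOn (contMDiffOn_symm_of_mem_maximalAtlas hφ))
    (contMDiffOn_coordVector hφ i) (contMDiffOn_coordVector hφ j)
  rw [← contMDiffOn_iff_contDiffOn]
  intro y hy
  have h1 := h y hy
  simp only [Bundle.contMDiffWithinAt_totalSpace] at h1
  exact h1.2

end GeodesicWalk

/-! ### The metric as a bilinear form, and Christoffel symbols. -/

namespace GeodesicWalk

section LinearCombinations

/-- The linear combination `∑ A i j • c i j`. -/
noncomputable def linearComb {W ι : Type*} [NormedAddCommGroup W] [NormedSpace ℝ W] [Fintype ι]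
    (A : ι → ι → ℝ) (c : ι → ι → W) : W :=
  ∑ i, ∑ j, A i j • c i j

variable {V ι : Type*} [NormedAddCommGroup V] [NormedSpace ℝ V] [Fintype ι]

lemma differentiableAt_linearComb {W : Type*} [NormedAddCommGroup W] [NormedSpace ℝ W]
    {f : V → ι → ι → ℝ} {y : V} (hf : ∀ i j, DifferentiableAt ℝ (fun y => f y i j) y)
    (c : ι → ι → W) : DifferentiableAt ℝ (fun y => linearComb (f y) c) y :=
  DifferentiableAt.fun_sum fun i _ => DifferentiableAt.fun_sum fun j _ =>
    (hf i j).smul_const (c i j)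

lemma linearComb_apply (A : ι → ι → ℝ) (c : ι → ι → V →L[ℝ] V →L[ℝ] ℝ) (u w : V) :
    linearComb A c u w = ∑ i, ∑ j, A i j * c i j u w := by
  unfold linearComb
  simp only [sum_apply]
  rfl

lemma fderiv_bilinear_apply {G : V → V →L[ℝ] V →L[ℝ] ℝ} {y : V} (hG : DifferentiableAt ℝ G y)
    (d u w : V) : fderiv ℝ G y d u w = fderiv ℝ (fun y => G y u w) y d := by
  have h1 : HasFDerivAt (fun y => G y u w) _ y :=
    (hG.hasFDerivAt.clm_apply (hasFDerivAt_const u y)).clm_apply (hasFDerivAt_const w y)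
  rw [h1.fderiv]
  simp

end LinearCombinations

section Coordinates

variable {n : ℕ}

lemma sum_smul_single (u : EuclideanSpace ℝ (Fin n)) :
    ∑ i, u i • EuclideanSpace.single i (1 : ℝ) = u := by
  ext j
  simp [Finset.sum_apply, Pi.single_apply]

/-- The map `T` allows `B` to live on a tangent space (with `T` a `chartLift`) as well as on
Euclidean space (with `T` the identity). -/
lemma bilinear_eq_sum {V : Type*} [AddCommGroup V] [Module ℝ V] (B : V →ₗ[ℝ] V →ₗ[ℝ] ℝ)
    (T : EuclideanSpace ℝ (Fin n) →ₗ[ℝ] V) (u w : EuclideanSpace ℝ (Fin n)) :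
    B (T u) (T w) = ∑ i, ∑ j,
      B (T (EuclideanSpace.single i 1)) (T (EuclideanSpace.single j 1)) * (u i * w j) := by
  conv_lhs => rw [← sum_smul_single u, ← sum_smul_single w]
  simp only [map_sum, map_smul, LinearMap.sum_apply, LinearMap.smul_apply, smul_eq_mul,
    Finset.mul_sum]
  rw [Finset.sum_comm]
  exact Finset.sum_congr rfl fun i _ => Finset.sum_congr rfl fun j _ => by ring

lemma fderiv_eq_sum_partialDeriv (h : EuclideanSpace ℝ (Fin n) → ℝ)
    (y d : EuclideanSpace ℝ (Fin n)) :
    fderiv ℝ h y d = ∑ k, d k * partialDeriv k h y := by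
  conv_lhs => rw [← sum_smul_single d]
  simp [partialDeriv]

end Coordinates

variable {n : ℕ} {M : Type*} [TopologicalSpace M]
  [ChartedSpace (EuclideanSpace ℝ (Fin n)) M] [IsManifold (𝓡 n) ∞ M]

/-- The components of tangent vectors at `p` in the coordinate system `φ`. -/
noncomputable def chartDeriv (φ : OpenPartialHomeomorph M (EuclideanSpace ℝ (Fin n))) (p : M) :
    TangentSpace (𝓡 n) p →L[ℝ] EuclideanSpace ℝ (Fin n) :=
  mfderiv (𝓡 n) (𝓡 n) φ p

/-- The tangent vector with given components in the coordinate system `φ`. -/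
noncomputable def chartLift (φ : OpenPartialHomeomorph M (EuclideanSpace ℝ (Fin n)))
    (y : EuclideanSpace ℝ (Fin n)) :
    EuclideanSpace ℝ (Fin n) →L[ℝ] TangentSpace (𝓡 n) (φ.symm y) :=
  mfderiv (𝓡 n) (𝓡 n) φ.symm y

lemma component_eq_chartDeriv (φ : OpenPartialHomeomorph M (EuclideanSpace ℝ (Fin n))) (p : M)
    (η : TangentSpace (𝓡 n) p) (i : Fin n) : component φ p η i = chartDeriv φ p η i := rfl

lemma chartDeriv_chartLift {φ : OpenPartialHomeomorph M (EuclideanSpace ℝ (Fin n))}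
    (hφ : φ ∈ charts n M) {y : EuclideanSpace ℝ (Fin n)} (hy : y ∈ φ.target)
    (u : EuclideanSpace ℝ (Fin n)) : chartDeriv φ (φ.symm y) (chartLift φ y u) = u :=
  congrArg (fun T => T u) ((mdifferentiable_chart hφ).comp_symm_deriv hy)

/-- The chart derivative is injective, so its right inverse is also a left inverse. -/
lemma chartLift_chartDeriv {φ : OpenPartialHomeomorph M (EuclideanSpace ℝ (Fin n))}
    (hφ : φ ∈ charts n M) {y : EuclideanSpace ℝ (Fin n)} (hy : y ∈ φ.target)
    (ξ : TangentSpace (𝓡 n) (φ.symm y)) : chartLift φ y (chartDeriv φ (φ.symm y) ξ) = ξ :=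
  (mdifferentiable_chart hφ).mfderiv_injective (φ.map_target hy)
    (chartDeriv_chartLift hφ hy (chartDeriv φ (φ.symm y) ξ))

/-- The metric in the coordinate system `φ`, as a bilinear form on Euclidean space. -/
noncomputable def metricForm (g : Metric n M)
    (φ : OpenPartialHomeomorph M (EuclideanSpace ℝ (Fin n))) (y : EuclideanSpace ℝ (Fin n)) :
    EuclideanSpace ℝ (Fin n) →L[ℝ] EuclideanSpace ℝ (Fin n) →L[ℝ] ℝ :=
  linearComb (metricMatrix g φ y) fun i j =>
    ContinuousLinearMap.smulRight (EuclideanSpace.proj i : EuclideanSpace ℝ (Fin n) →L[ℝ] ℝ)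
      (EuclideanSpace.proj j : EuclideanSpace ℝ (Fin n) →L[ℝ] ℝ)

/-- The quadratic vector valued form `v ↦ ∑ Γ^k_{ij} v^i v^j` in the coordinate system `φ`. -/
noncomputable def christoffelVec (g : Metric n M)
    (φ : OpenPartialHomeomorph M (EuclideanSpace ℝ (Fin n))) (y v : EuclideanSpace ℝ (Fin n)) :
    EuclideanSpace ℝ (Fin n) :=
  WithLp.toLp 2 fun k => ∑ i, ∑ j, christoffel g φ k i j y * v i * v j

variable (g : Metric n M) {φ : OpenPartialHomeomorph M (EuclideanSpace ℝ (Fin n))}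

lemma metricForm_apply (y u w : EuclideanSpace ℝ (Fin n)) :
    metricForm g φ y u w = ∑ i, ∑ j, metricMatrix g φ y i j * (u i * w j) := by
  refine (linearComb_apply _ _ u w).trans ?_
  simp

lemma metricForm_eq_inner (y u w : EuclideanSpace ℝ (Fin n)) :
    metricForm g φ y u w = g.inner (φ.symm y) (chartLift φ y u) (chartLift φ y w) := by
  rw [metricForm_apply]
  exact (bilinear_eq_sum (LinearMap.mk₂ ℝ (fun ξ ζ => g.inner (φ.symm y) ξ ζ)
    (by simp) (by simp) (by simp) (by simp)) (chartLift φ y).toLinearMap u w).symm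

lemma metricForm_symm (y u w : EuclideanSpace ℝ (Fin n)) :
    metricForm g φ y u w = metricForm g φ y w u := by
  rw [metricForm_eq_inner, metricForm_eq_inner, g.symm]

lemma metricForm_pos (hφ : φ ∈ charts n M) {y : EuclideanSpace ℝ (Fin n)} (hy : y ∈ φ.target)
    {u : EuclideanSpace ℝ (Fin n)} (hu : u ≠ 0) : 0 < metricForm g φ y u u := by
  rw [metricForm_eq_inner]
  refine g.pos _ _ fun h => hu ?_
  exact (mdifferentiable_chart hφ).symm.mfderiv_injective hy (h.trans (map_zero _).symm)

/-- The metric at a point is the coordinate metric of the components. -/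
lemma inner_eq_metricForm (hφ : φ ∈ charts n M) {p : M} (hp : p ∈ φ.source)
    (ξ ζ : TangentSpace (𝓡 n) p) :
    g.inner p ξ ζ = metricForm g φ (φ p) (chartDeriv φ p ξ) (chartDeriv φ p ζ) := by
  obtain ⟨y, hy, rfl⟩ : ∃ y ∈ φ.target, φ.symm y = p := ⟨φ p, φ.map_source hp, φ.left_inv hp⟩
  rw [φ.right_inv hy, metricForm_eq_inner, chartLift_chartDeriv hφ hy, chartLift_chartDeriv hφ hy]

lemma differentiableAt_metricMatrix (hφ : φ ∈ charts n M) {y : EuclideanSpace ℝ (Fin n)}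
    (hy : y ∈ φ.target) (i j : Fin n) :
    DifferentiableAt ℝ (fun y => metricMatrix g φ y i j) y :=
  ((contDiffOn_metricMatrix g hφ i j).contDiffAt (φ.open_target.mem_nhds hy)).differentiableAt
    (by simp)

lemma differentiableAt_metricForm (hφ : φ ∈ charts n M) {y : EuclideanSpace ℝ (Fin n)}
    (hy : y ∈ φ.target) : DifferentiableAt ℝ (metricForm g φ) y :=
  differentiableAt_linearComb (differentiableAt_metricMatrix g hφ hy) _

lemma continuousOn_metricForm (hφ : φ ∈ charts n M) : ContinuousOn (metricForm g φ) φ.target :=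
  fun _ hy => (differentiableAt_metricForm g hφ hy).continuousAt.continuousWithinAt

lemma fderiv_metricForm_apply (hφ : φ ∈ charts n M) {y : EuclideanSpace ℝ (Fin n)}
    (hy : y ∈ φ.target) (d u w : EuclideanSpace ℝ (Fin n)) :
    fderiv ℝ (metricForm g φ) y d u w = ∑ i, ∑ j, ∑ k,
      d k * partialDeriv k (fun y => metricMatrix g φ y i j) y * (u i * w j) := by
  rw [fderiv_bilinear_apply (differentiableAt_metricForm g hφ hy)]
  simp only [metricForm_apply]
  have h : HasFDerivAt (fun y => ∑ i, ∑ j, metricMatrix g φ y i j * (u i * w j)) _ y :=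
    HasFDerivAt.fun_sum fun i _ => HasFDerivAt.fun_sum fun j _ =>
      (differentiableAt_metricMatrix g hφ hy i j).hasFDerivAt.mul_const (u i * w j)
  rw [h.fderiv]
  simp [sum_apply, fderiv_eq_sum_partialDeriv, Finset.mul_sum, mul_comm]

/-- A nonzero kernel vector would have zero length, against positivity. -/
lemma metricMatrix_det_ne_zero (hφ : φ ∈ charts n M) {y : EuclideanSpace ℝ (Fin n)}
    (hy : y ∈ φ.target) : (metricMatrix g φ y).det ≠ 0 := by
  intro h
  obtain ⟨v, hv, h0⟩ := Matrix.exists_mulVec_eq_zero_iff.2 h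
  have hv' : (WithLp.toLp 2 v : EuclideanSpace ℝ (Fin n)) ≠ 0 := by simpa using hv
  have := metricForm_pos g hφ hy hv'
  rw [metricForm_apply] at this
  refine this.ne' ?_
  refine Finset.sum_eq_zero fun i _ => ?_
  have h1 := congrFun h0 i
  simp only [Matrix.mulVec, dotProduct, Pi.zero_apply] at h1
  calc _ = v i * ∑ j, metricMatrix g φ y i j * v j := by
        rw [Finset.mul_sum]; exact Finset.sum_congr rfl fun j _ => by simp; ring
    _ = 0 := by rw [h1, mul_zero]

lemma contDiffOn_inverseMetric (hφ : φ ∈ charts n M) (i j : Fin n) :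
    ContDiffOn ℝ ∞ (fun y => inverseMetric g φ y i j) φ.target :=
  contDiffOn_matrix_inv (contDiffOn_metricMatrix g hφ)
    (fun _ hy => metricMatrix_det_ne_zero g hφ hy) i j

lemma contDiffOn_partialDeriv {h : EuclideanSpace ℝ (Fin n) → ℝ}
    {s : Set (EuclideanSpace ℝ (Fin n))} (hs : IsOpen s) (hh : ContDiffOn ℝ ∞ h s) (i : Fin n) :
    ContDiffOn ℝ ∞ (partialDeriv i h) s :=
  (hh.fderiv_of_isOpen hs (by simp)).clm_apply contDiffOn_const

lemma contDiffOn_christoffel (hφ : φ ∈ charts n M) (k i j : Fin n) :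
    ContDiffOn ℝ ∞ (christoffel g φ k i j) φ.target := by
  unfold christoffel
  refine contDiffOn_const.mul (ContDiffOn.sum fun l _ =>
    (contDiffOn_inverseMetric g hφ k l).mul (((?_ : ContDiffOn _ _ _ _).add ?_).sub ?_)) <;>
  exact contDiffOn_partialDeriv φ.open_target (contDiffOn_metricMatrix g hφ _ _) _

/-- Lowering the upper index cancels the inverse matrix in the Christoffel symbols. -/
lemma sum_metricMatrix_mul_christoffel (hφ : φ ∈ charts n M) {y : EuclideanSpace ℝ (Fin n)}
    (hy : y ∈ φ.target) (m i j : Fin n) :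
    ∑ k, metricMatrix g φ y m k * christoffel g φ k i j y = (1 / 2) *
      (partialDeriv i (fun z => metricMatrix g φ z j m) y
        + partialDeriv j (fun z => metricMatrix g φ z i m) y
        - partialDeriv m (fun z => metricMatrix g φ z i j) y) := by
  set c : Fin n → ℝ := fun l => partialDeriv i (fun z => metricMatrix g φ z j l) y
        + partialDeriv j (fun z => metricMatrix g φ z i l) y
        - partialDeriv l (fun z => metricMatrix g φ z i j) y with hc
  have h1 : (metricMatrix g φ y).mulVec ((inverseMetric g φ y).mulVec c) = c := by
    rw [Matrix.mulVec_mulVec, inverseMetric,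
      Matrix.mul_nonsing_inv _ (isUnit_iff_ne_zero.2 (metricMatrix_det_ne_zero g hφ hy)),
      Matrix.one_mulVec]
  have h2 := congrFun h1 m
  rw [← hc] at *
  change _ = (1 / 2) * c m
  rw [← h2]
  simp only [Matrix.mulVec, dotProduct, christoffel, Finset.mul_sum]
  exact Finset.sum_congr rfl fun k _ => Finset.sum_congr rfl fun l _ => by ring

/-- After contraction with `v i * v j` the first two derivative terms of the Christoffel symbols
coincide, so the factor `1/2` remains only on the third. -/
lemma metricForm_christoffelVec (hφ : φ ∈ charts n M) {y : EuclideanSpace ℝ (Fin n)}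
    (hy : y ∈ φ.target) (v z : EuclideanSpace ℝ (Fin n)) :
    metricForm g φ y (christoffelVec g φ y v) z =
      fderiv ℝ (metricForm g φ) y v v z - (1 / 2) * fderiv ℝ (metricForm g φ) y z v v := by
  have h1 : metricForm g φ y (christoffelVec g φ y v) z = ∑ i, ∑ j, ∑ m, (1 / 2) *
      (partialDeriv i (fun z => metricMatrix g φ z j m) y
        + partialDeriv j (fun z => metricMatrix g φ z i m) y
        - partialDeriv m (fun z => metricMatrix g φ z i j) y) * (v i * v j * z m) := by
    rw [metricForm_symm, metricForm_apply]
    simp only [← sum_metricMatrix_mul_christoffel g hφ hy, christoffelVec, Finset.mul_sum,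
      Finset.sum_mul]
    calc _ = ∑ m, ∑ k, ∑ i, ∑ j, metricMatrix g φ y m k * christoffel g φ k i j y *
          (v i * v j * z m) :=
          Finset.sum_congr rfl fun m _ => Finset.sum_congr rfl fun k _ =>
            Finset.sum_congr rfl fun i _ => Finset.sum_congr rfl fun j _ => by ring
      _ = ∑ m, ∑ i, ∑ j, ∑ k, metricMatrix g φ y m k * christoffel g φ k i j y *
          (v i * v j * z m) := by
          refine Finset.sum_congr rfl fun m _ => ?_
          rw [Finset.sum_comm]
          exact Finset.sum_congr rfl fun i _ => Finset.sum_comm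
      _ = _ := by
          rw [Finset.sum_comm]
          exact Finset.sum_congr rfl fun i _ => Finset.sum_comm
  have h2 : fderiv ℝ (metricForm g φ) y v v z = ∑ i, ∑ j, ∑ m,
      partialDeriv i (fun z => metricMatrix g φ z j m) y * (v i * v j * z m) := by
    rw [fderiv_metricForm_apply g hφ hy]
    calc _ = ∑ j, ∑ m, ∑ i, partialDeriv i (fun z => metricMatrix g φ z j m) y *
          (v i * v j * z m) :=
          Finset.sum_congr rfl fun j _ => Finset.sum_congr rfl fun m _ =>
            Finset.sum_congr rfl fun i _ => by ring
      _ = ∑ j, ∑ i, ∑ m, partialDeriv i (fun z => metricMatrix g φ z j m) y *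
          (v i * v j * z m) := Finset.sum_congr rfl fun j _ => Finset.sum_comm
      _ = _ := Finset.sum_comm
  have h3 : fderiv ℝ (metricForm g φ) y v v z = ∑ i, ∑ j, ∑ m,
      partialDeriv j (fun z => metricMatrix g φ z i m) y * (v i * v j * z m) := by
    rw [h2, Finset.sum_comm]
    exact Finset.sum_congr rfl fun j _ => Finset.sum_congr rfl fun i _ =>
      Finset.sum_congr rfl fun m _ => by ring
  have h4 : fderiv ℝ (metricForm g φ) y z v v = ∑ i, ∑ j, ∑ m,
      partialDeriv m (fun z => metricMatrix g φ z i j) y * (v i * v j * z m) := by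
    rw [fderiv_metricForm_apply g hφ hy]
    exact Finset.sum_congr rfl fun i _ => Finset.sum_congr rfl fun j _ =>
      Finset.sum_congr rfl fun m _ => by ring
  have h5 : fderiv ℝ (metricForm g φ) y v v z - (1 / 2) * fderiv ℝ (metricForm g φ) y z v v =
      (1 / 2) * (fderiv ℝ (metricForm g φ) y v v z + fderiv ℝ (metricForm g φ) y v v z
        - fderiv ℝ (metricForm g φ) y z v v) := by ring
  rw [h5, h1, h4]
  -- The two copies of the same derivative are expanded with `i` and `j` exchanged, to match the two
  -- terms of the Christoffel symbol.
  nth_rw 1 [h2]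
  rw [h3, ← Finset.sum_add_distrib, ← Finset.sum_sub_distrib, Finset.mul_sum]
  refine Finset.sum_congr rfl fun i _ => ?_
  rw [← Finset.sum_add_distrib, ← Finset.sum_sub_distrib, Finset.mul_sum]
  refine Finset.sum_congr rfl fun j _ => ?_
  rw [← Finset.sum_add_distrib, ← Finset.sum_sub_distrib, Finset.mul_sum]
  exact Finset.sum_congr rfl fun m _ => by ring

/-- This identifies the geodesic equation with the Euler-Lagrange equation, whose behaviour under
coordinate changes is known. -/
lemma metricForm_add_christoffelVec (hφ : φ ∈ charts n M) {y : EuclideanSpace ℝ (Fin n)}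
    (hy : y ∈ φ.target) (v a z : EuclideanSpace ℝ (Fin n)) :
    metricForm g φ y (a + christoffelVec g φ y v) z = eulerLagrange (metricForm g φ) y v a z := by
  rw [map_add, _root_.add_apply, metricForm_christoffelVec g hφ hy, eulerLagrange]
  ring

lemma contDiffOn_christoffelVec (hφ : φ ∈ charts n M) :
    ContDiffOn ℝ ∞ (fun z : EuclideanSpace ℝ (Fin n) × EuclideanSpace ℝ (Fin n) =>
      christoffelVec g φ z.1 z.2) (φ.target ×ˢ univ) := by
  rw [contDiffOn_euclidean]
  intro k
  simp only [christoffelVec]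
  refine ContDiffOn.sum fun i _ => ContDiffOn.sum fun j _ => ?_
  refine (((contDiffOn_christoffel g hφ k i j).comp contDiffOn_fst fun z hz => hz.1).mul ?_).mul ?_
  all_goals
    refine ContDiff.contDiffOn ?_
    fun_prop

end GeodesicWalk

/-! ### Change of coordinates in the geodesic equation. -/

namespace GeodesicWalk

variable {n : ℕ} {M : Type*} [TopologicalSpace M]
  [ChartedSpace (EuclideanSpace ℝ (Fin n)) M] [IsManifold (𝓡 n) ∞ M]

section Transition

variable {φ φ' : OpenPartialHomeomorph M (EuclideanSpace ℝ (Fin n))}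

lemma isOpen_transition_domain :
    IsOpen (φ.target ∩ φ.symm ⁻¹' φ'.source) :=
  φ.isOpen_inter_preimage_symm φ'.open_source

lemma contDiffOn_transition (hφ : φ ∈ charts n M) (hφ' : φ' ∈ charts n M) :
    ContDiffOn ℝ ∞ (fun y => φ' (φ.symm y)) (φ.target ∩ φ.symm ⁻¹' φ'.source) := by
  rw [← contMDiffOn_iff_contDiffOn]
  exact (contMDiffOn_of_mem_maximalAtlas hφ').comp
    ((contMDiffOn_symm_of_mem_maximalAtlas hφ).mono inter_subset_left) fun y hy => hy.2

lemma contDiffAt_transition (hφ : φ ∈ charts n M) (hφ' : φ' ∈ charts n M)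
    {y : EuclideanSpace ℝ (Fin n)} (hy : y ∈ φ.target ∩ φ.symm ⁻¹' φ'.source) :
    ContDiffAt ℝ ∞ (fun y => φ' (φ.symm y)) y :=
  (contDiffOn_transition hφ hφ').contDiffAt (isOpen_transition_domain.mem_nhds hy)

lemma fderiv_transition (hφ : φ ∈ charts n M) (hφ' : φ' ∈ charts n M)
    {y : EuclideanSpace ℝ (Fin n)} (hy : y ∈ φ.target ∩ φ.symm ⁻¹' φ'.source)
    (u : EuclideanSpace ℝ (Fin n)) :
    fderiv ℝ (fun y => φ' (φ.symm y)) y u = chartDeriv φ' (φ.symm y) (chartLift φ y u) := by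
  rw [← mfderiv_eq_fderiv]
  exact congrArg (fun T => T u) (mfderiv_comp y ((mdifferentiable_chart hφ').mdifferentiableAt hy.2)
    ((mdifferentiable_chart hφ).mdifferentiableAt_symm hy.1))

lemma metricForm_transition (g : Metric n M) (hφ : φ ∈ charts n M) (hφ' : φ' ∈ charts n M)
    {y : EuclideanSpace ℝ (Fin n)} (hy : y ∈ φ.target ∩ φ.symm ⁻¹' φ'.source)
    (u w : EuclideanSpace ℝ (Fin n)) :
    metricForm g φ y u w = metricForm g φ' (φ' (φ.symm y))
      (fderiv ℝ (fun y => φ' (φ.symm y)) y u) (fderiv ℝ (fun y => φ' (φ.symm y)) y w) := by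
  rw [metricForm_eq_inner, inner_eq_metricForm g hφ' hy.2, fderiv_transition hφ hφ' hy,
    fderiv_transition hφ hφ' hy]

/-- Because of this, a vector can be shown to vanish by pairing it only with vectors of the form
`fderiv ℝ ψ y z`. -/
lemma fderiv_transition_surjective (hφ : φ ∈ charts n M) (hφ' : φ' ∈ charts n M)
    {y : EuclideanSpace ℝ (Fin n)} (hy : y ∈ φ.target ∩ φ.symm ⁻¹' φ'.source)
    (b : EuclideanSpace ℝ (Fin n)) : ∃ z, fderiv ℝ (fun y => φ' (φ.symm y)) y z = b := by
  obtain ⟨ξ, hξ⟩ := (mdifferentiable_chart hφ').mfderiv_surjective hy.2 b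
  refine ⟨chartDeriv φ (φ.symm y) ξ, ?_⟩
  rw [fderiv_transition hφ hφ' hy, chartLift_chartDeriv hφ hy.1]
  exact hξ

/-- The geodesic equation is invariant under changes of coordinates. -/
lemma christoffelVec_transition (g : Metric n M) (hφ : φ ∈ charts n M) (hφ' : φ' ∈ charts n M)
    {y : EuclideanSpace ℝ (Fin n)} (hy : y ∈ φ.target ∩ φ.symm ⁻¹' φ'.source)
    (v a : EuclideanSpace ℝ (Fin n)) (ha : a + christoffelVec g φ y v = 0) :
    fderiv ℝ (fun y => φ' (φ.symm y)) y a + fderiv ℝ (fderiv ℝ (fun y => φ' (φ.symm y))) y v v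
      + christoffelVec g φ' (φ' (φ.symm y)) (fderiv ℝ (fun y => φ' (φ.symm y)) y v) = 0 := by
  set ψ := fun y => φ' (φ.symm y) with hψ
  have hy' : ψ y ∈ φ'.target := φ'.map_source hy.2
  -- Paired with `fderiv ℝ ψ y z`, the transformed equation is the Euler-Lagrange expression in the
  -- old chart, which vanishes by `ha`.
  have key : ∀ z, metricForm g φ' (ψ y) (fderiv ℝ ψ y a + fderiv ℝ (fderiv ℝ ψ) y v v
      + christoffelVec g φ' (ψ y) (fderiv ℝ ψ y v)) (fderiv ℝ ψ y z) = 0 := by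
    intro z
    rw [metricForm_add_christoffelVec g hφ' hy', ← eulerLagrange_comp
      ((contDiffAt_transition hφ hφ' hy).of_le (by norm_cast))
      (differentiableAt_metricForm g hφ' hy')
      (differentiableAt_metricForm g hφ hy.1) (metricForm_symm g (ψ y)) ?_,
      ← metricForm_add_christoffelVec g hφ hy.1, ha]
    · simp
    · filter_upwards [isOpen_transition_domain.mem_nhds hy] with x hx u w
      exact metricForm_transition g hφ hφ' hx u w
  by_contra hne
  obtain ⟨z, hz⟩ := fderiv_transition_surjective hφ hφ' hy (fderiv ℝ ψ y a +
    fderiv ℝ (fderiv ℝ ψ) y v v + christoffelVec g φ' (ψ y) (fderiv ℝ ψ y v))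
  have h1 := key z
  rw [hz] at h1
  exact (metricForm_pos g hφ' hy' hne).ne' h1

end Transition

/-! ### Geodesics as integral curves of the geodesic field. -/

section Curves

lemma hasDerivAt_euclidean_apply {y : ℝ → EuclideanSpace ℝ (Fin n)}
    {y' : EuclideanSpace ℝ (Fin n)} {t : ℝ} (h : HasDerivAt y y' t) (k : Fin n) :
    HasDerivAt (fun τ => y τ k) (y' k) t :=
  ((EuclideanSpace.proj k : EuclideanSpace ℝ (Fin n) →L[ℝ] ℝ).hasFDerivAt.comp_hasDerivAt t h)

/-- This links the componentwise iterated `deriv` in `IsGeodesicOn` to one vector equation. The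
first derivative must be known near `t`, since it is differentiated again. -/
lemma geodesic_equation_iff (g : Metric n M) (φ : OpenPartialHomeomorph M (EuclideanSpace ℝ (Fin n)))
    {y y₁ : ℝ → EuclideanSpace ℝ (Fin n)} {a : EuclideanSpace ℝ (Fin n)} {t : ℝ}
    (h₁ : ∀ᶠ τ in 𝓝 t, HasDerivAt y (y₁ τ) τ) (h₂ : HasDerivAt y₁ a t) :
    (∀ k, deriv (deriv fun τ => y τ k) t
        + ∑ i, ∑ j, christoffel g φ k i j (y t)
            * deriv (fun τ => y τ i) t * deriv (fun τ => y τ j) t = 0) ↔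
      a + christoffelVec g φ (y t) (y₁ t) = 0 := by
  have hd : ∀ k, deriv (fun τ => y τ k) t = y₁ t k := fun k =>
    (hasDerivAt_euclidean_apply h₁.self_of_nhds k).deriv
  have hdd : ∀ k, deriv (deriv fun τ => y τ k) t = a k := by
    intro k
    have : (deriv fun τ => y τ k) =ᶠ[𝓝 t] fun τ => y₁ τ k :=
      h₁.mono fun τ hτ => (hasDerivAt_euclidean_apply hτ k).deriv
    rw [this.deriv_eq, (hasDerivAt_euclidean_apply h₂ k).deriv]
  simp only [hd, hdd]
  constructor
  · intro h
    ext k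
    simpa [christoffelVec] using h k
  · intro h k
    have := congrArg (fun v : EuclideanSpace ℝ (Fin n) => v k) h
    simpa [christoffelVec] using this

lemma hasDerivAt_fst_comp {V W : Type*} [NormedAddCommGroup V] [NormedSpace ℝ V]
    [NormedAddCommGroup W] [NormedSpace ℝ W] {c : ℝ → V × W} {c' : V × W} {t : ℝ}
    (h : HasDerivAt c c' t) : HasDerivAt (fun t => (c t).1) c'.1 t :=
  (ContinuousLinearMap.fst ℝ V W).hasFDerivAt.comp_hasDerivAt t h

lemma hasDerivAt_snd_comp {V W : Type*} [NormedAddCommGroup V] [NormedSpace ℝ V]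
    [NormedAddCommGroup W] [NormedSpace ℝ W] {c : ℝ → V × W} {c' : V × W} {t : ℝ}
    (h : HasDerivAt c c' t) : HasDerivAt (fun t => (c t).2) c'.2 t :=
  (ContinuousLinearMap.snd ℝ V W).hasFDerivAt.comp_hasDerivAt t h

lemma hasDerivAt_fderiv_comp {V W : Type*} [NormedAddCommGroup V] [NormedSpace ℝ V]
    [NormedAddCommGroup W] [NormedSpace ℝ W] {ψ : V → W} {x v : ℝ → V} {x' v' : V} {t : ℝ}
    (hψ : ContDiffAt ℝ 2 ψ (x t)) (hx : HasDerivAt x x' t) (hv : HasDerivAt v v' t) :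
    HasDerivAt (fun τ => fderiv ℝ ψ (x τ) (v τ))
      (fderiv ℝ (fderiv ℝ ψ) (x t) x' (v t) + fderiv ℝ ψ (x t) v') t :=
  ((((hψ.fderiv_right (m := 1) (by norm_num)).differentiableAt
    (by simp)).hasFDerivAt.comp_hasDerivAt t hx).clm_apply hv)

/-- The geodesic vector field on position-velocity pairs in the coordinate system `φ`. -/
noncomputable def geodesicField (g : Metric n M)
    (φ : OpenPartialHomeomorph M (EuclideanSpace ℝ (Fin n)))
    (z : EuclideanSpace ℝ (Fin n) × EuclideanSpace ℝ (Fin n)) :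
    EuclideanSpace ℝ (Fin n) × EuclideanSpace ℝ (Fin n) :=
  (z.2, -christoffelVec g φ z.1 z.2)

variable (g : Metric n M) {φ : OpenPartialHomeomorph M (EuclideanSpace ℝ (Fin n))}

lemma contDiffAt_geodesicField (hφ : φ ∈ charts n M)
    {z : EuclideanSpace ℝ (Fin n) × EuclideanSpace ℝ (Fin n)} (hz : z.1 ∈ φ.target) :
    ContDiffAt ℝ ∞ (geodesicField g φ) z :=
  contDiffAt_snd.prodMk ((contDiffOn_christoffelVec g hφ).contDiffAt
    ((φ.open_target.prod isOpen_univ).mem_nhds ⟨hz, trivial⟩)).neg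

/-- Bootstrapping: `c` is continuous, so `c' = geodesicField g φ c` is continuous and `c` is `C¹`;
the derivative of the position is the velocity, itself `C¹`. -/
lemma contDiffOn_two_of_geodesicField (hφ : φ ∈ charts n M)
    {c : ℝ → EuclideanSpace ℝ (Fin n) × EuclideanSpace ℝ (Fin n)} {s : Set ℝ} (hs : IsOpen s)
    (hc : ∀ t ∈ s, HasDerivAt c (geodesicField g φ (c t)) t ∧ (c t).1 ∈ φ.target) :
    ContDiffOn ℝ 2 (fun t => (c t).1) s := by
  have hcc : ContinuousOn c s := fun t ht => (hc t ht).1.continuousAt.continuousWithinAt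
  have hc1 : ContDiffOn ℝ 1 c s := by
    rw [show (1 : WithTop ℕ∞) = 0 + 1 by norm_num, contDiffOn_succ_iff_deriv_of_isOpen hs]
    refine ⟨fun t ht => (hc t ht).1.differentiableAt.differentiableWithinAt, by simp, ?_⟩
    rw [contDiffOn_zero]
    refine ContinuousOn.congr (f := fun t => geodesicField g φ (c t)) ?_
      fun t ht => (hc t ht).1.deriv
    intro t ht
    exact (contDiffAt_geodesicField g hφ (hc t ht).2).continuousAt.comp_continuousWithinAt
      (hcc t ht)
  have hd : ∀ t ∈ s, HasDerivAt (fun t => (c t).1) (c t).2 t := fun t ht =>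
    hasDerivAt_fst_comp (hc t ht).1
  rw [show (2 : WithTop ℕ∞) = 1 + 1 by norm_num, contDiffOn_succ_iff_deriv_of_isOpen hs]
  refine ⟨fun t ht => (hd t ht).differentiableAt.differentiableWithinAt, by simp, ?_⟩
  exact (contDiff_snd.comp_contDiffOn hc1).congr fun t ht => (hd t ht).deriv

/-- A solution of the geodesic equation in one coordinate system is a geodesic. -/
lemma isGeodesicOn_of_geodesicField (hφ : φ ∈ charts n M)
    {c : ℝ → EuclideanSpace ℝ (Fin n) × EuclideanSpace ℝ (Fin n)} {s : Set ℝ} (hs : IsOpen s)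
    (hc : ∀ t ∈ s, HasDerivAt c (geodesicField g φ (c t)) t ∧ (c t).1 ∈ φ.target) :
    IsGeodesicOn g (fun t => φ.symm (c t).1) s := by
  refine ⟨((contMDiffOn_symm_of_mem_maximalAtlas hφ).of_le (by norm_cast)).comp
    (contDiffOn_two_of_geodesicField g hφ hs hc).contMDiffOn fun t ht => (hc t ht).2, ?_⟩
  intro φ' hφ' t ht hsrc
  set ψ := fun y => φ' (φ.symm y) with hψ
  have hx : ∀ t ∈ s, HasDerivAt (fun t => (c t).1) (c t).2 t := fun t ht =>
    hasDerivAt_fst_comp (hc t ht).1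
  have hv : ∀ t ∈ s, HasDerivAt (fun t => (c t).2) (-christoffelVec g φ (c t).1 (c t).2) t :=
    fun t ht => hasDerivAt_snd_comp (hc t ht).1
  have hdom : (c t).1 ∈ φ.target ∩ φ.symm ⁻¹' φ'.source := ⟨(hc t ht).2, hsrc⟩
  have hψ2 := contDiffAt_transition hφ hφ' hdom
  have h₁ : ∀ᶠ τ in 𝓝 t, HasDerivAt (fun τ => ψ (c τ).1) (fderiv ℝ ψ (c τ).1 (c τ).2) τ := by
    filter_upwards [hs.mem_nhds ht, (hx t ht).continuousAt.eventually
      (isOpen_transition_domain.mem_nhds hdom)] with τ hτ hτ'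
    exact ((contDiffAt_transition hφ hφ' hτ').differentiableAt
      (by simp)).hasFDerivAt.comp_hasDerivAt τ (hx τ hτ)
  have h₂ : HasDerivAt (fun τ => fderiv ℝ ψ (c τ).1 (c τ).2)
      (fderiv ℝ (fderiv ℝ ψ) (c t).1 (c t).2 (c t).2
        + fderiv ℝ ψ (c t).1 (-christoffelVec g φ (c t).1 (c t).2)) t :=
    hasDerivAt_fderiv_comp (hψ2.of_le (by norm_cast)) (hx t ht) (hv t ht)
  refine (geodesic_equation_iff g φ' h₁ h₂).2 ?_
  rw [add_comm (fderiv ℝ (fderiv ℝ ψ) _ _ _)]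
  exact christoffelVec_transition g hφ hφ' hdom _ _ (by simp)

/-- In a coordinate system, a geodesic solves the geodesic equation. -/
lemma IsGeodesicOn.hasDerivAt {γ : ℝ → M} {s : Set ℝ} (hγ : IsGeodesicOn g γ s) (hs : IsOpen s)
    (hφ : φ ∈ charts n M) {t : ℝ} (ht : t ∈ s) (hsrc : γ t ∈ φ.source) :
    HasDerivAt (fun τ => (φ (γ τ), deriv (fun τ => φ (γ τ)) τ))
      (geodesicField g φ (φ (γ t), deriv (fun τ => φ (γ τ)) t)) t := by
  have hC : ContDiffAt ℝ 2 (fun τ => φ (γ τ)) t := by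
    rw [← contMDiffAt_iff_contDiffAt]
    exact ((contMDiffAt_of_mem_maximalAtlas hφ hsrc).of_le (by norm_cast)).comp t
      (hγ.1.contMDiffAt (hs.mem_nhds ht))
  have h₁ : ∀ᶠ τ in 𝓝 t, HasDerivAt (fun τ => φ (γ τ)) (deriv (fun τ => φ (γ τ)) τ) τ := by
    filter_upwards [hC.eventually (by simp)] with τ hτ
    exact (hτ.differentiableAt (by simp)).hasDerivAt
  have h₂ : HasDerivAt (deriv (fun τ => φ (γ τ))) (deriv (deriv (fun τ => φ (γ τ))) t) t := by
    have : ContDiffAt ℝ 1 (deriv (fun τ => φ (γ τ))) t := hC.derivWithin (by norm_num)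
    exact (this.differentiableAt (by simp)).hasDerivAt
  have h₃ := (geodesic_equation_iff g φ h₁ h₂).1 (hγ.2 φ hφ t ht hsrc)
  rw [eq_neg_of_add_eq_zero_left h₃] at h₂
  exact h₁.self_of_nhds.prodMk h₂

end Curves

end GeodesicWalk

/-! ### Initial conditions and uniqueness of geodesics. -/

namespace GeodesicWalk

variable {n : ℕ} {M : Type*} [TopologicalSpace M]
  [ChartedSpace (EuclideanSpace ℝ (Fin n)) M] [IsManifold (𝓡 n) ∞ M]
  (g : Metric n M) {φ : OpenPartialHomeomorph M (EuclideanSpace ℝ (Fin n))}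

section InitialCondition

lemma deriv_chart_comp {γ : ℝ → M} {t : ℝ} (hγ : MDifferentiableAt 𝓘(ℝ, ℝ) (𝓡 n) γ t)
    (hφ : φ ∈ charts n M) (hsrc : γ t ∈ φ.source) :
    deriv (fun τ => φ (γ τ)) t =
      chartDeriv φ (γ t) (mfderiv 𝓘(ℝ, ℝ) (𝓡 n) γ t (1 : ℝ)) := by
  rw [← fderiv_apply_one_eq_deriv, ← mfderiv_eq_fderiv]
  exact congrArg (fun T => T (1 : ℝ))
    (mfderiv_comp t ((mdifferentiable_chart hφ).mdifferentiableAt hsrc) hγ)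

/-- The chart is arbitrary, so the same initial condition can be passed from one chart to another.
-/
lemma tangentMap_eq_iff {γ : ℝ → M} (hγ : MDifferentiableAt 𝓘(ℝ, ℝ) (𝓡 n) γ 0)
    (hφ : φ ∈ charts n M) {p : M} (hp : p ∈ φ.source) (η : TangentSpace (𝓡 n) p) :
    tangentMap 𝓘(ℝ, ℝ) (𝓡 n) γ ⟨0, (1 : ℝ)⟩ = ⟨p, η⟩ ↔
      γ 0 = p ∧ deriv (fun τ => φ (γ τ)) 0 = chartDeriv φ p η := by
  constructor
  · intro h
    obtain rfl : γ 0 = p := congrArg Bundle.TotalSpace.proj h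
    refine ⟨rfl, ?_⟩
    rw [deriv_chart_comp hγ hφ hp]
    have h2 := (Bundle.TotalSpace.mk.injEq _ _ _ _).mp h
    exact congrArg _ (eq_of_heq h2.2)
  · rintro ⟨rfl, h⟩
    rw [deriv_chart_comp hγ hφ hp] at h
    have h2 := (mdifferentiable_chart hφ).mfderiv_injective hp h
    exact congrArg (Bundle.TotalSpace.mk (γ 0)) h2

end InitialCondition

section Uniqueness

/-- A geodesic coincides with the solution of the geodesic equation in a coordinate system that has
the same initial position and velocity. -/
lemma IsGeodesicOn.eq_of_geodesicField [T2Space M] (hφ : φ ∈ charts n M)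
    {c : ℝ → EuclideanSpace ℝ (Fin n) × EuclideanSpace ℝ (Fin n)} {γ : ℝ → M} {a b a' b' : ℝ}
    (hc : ∀ t ∈ Ioo a' b', HasDerivAt c (geodesicField g φ (c t)) t ∧ (c t).1 ∈ φ.target)
    (hγ : IsGeodesicOn g γ (Ioo a b)) (h0 : 0 ∈ Ioo a b) (h0' : 0 ∈ Ioo a' b')
    (hsrc : γ 0 ∈ φ.source) (hinit : c 0 = (φ (γ 0), deriv (fun τ => φ (γ τ)) 0))
    {t : ℝ} (ht : t ∈ Ioo a b) (ht' : t ∈ Ioo a' b') : γ t = φ.symm (c t).1 := by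
  set I := Ioo (max a a') (min b b') with hI
  have hmem : ∀ τ, τ ∈ I ↔ τ ∈ Ioo a b ∧ τ ∈ Ioo a' b' := by
    intro τ
    simp only [hI, mem_Ioo, max_lt_iff, lt_min_iff]
    tauto
  -- `S` is open by local ODE uniqueness and relatively closed in the interval `I`; containing `0`,
  -- it is all of `I`.
  set S := {τ | τ ∈ I ∧ γ τ ∈ φ.source ∧ (φ (γ τ), deriv (fun τ => φ (γ τ)) τ) = c τ} with hS
  have hγc : ∀ τ ∈ I, ContinuousAt γ τ := fun τ hτ =>
    hγ.1.continuousOn.continuousAt (isOpen_Ioo.mem_nhds ((hmem τ).1 hτ).1)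
  have hopen : IsOpen S := by
    rw [isOpen_iff_mem_nhds]
    rintro τ ⟨hτ, hτs, hτe⟩
    have hd := hγ.hasDerivAt g isOpen_Ioo hφ ((hmem τ).1 hτ).1 hτs
    have hcτ := hc τ ((hmem τ).1 hτ).2
    obtain ⟨K, V, hV, hK⟩ := ((contDiffAt_geodesicField g hφ hcτ.2).of_le
      (m := 1) (by norm_cast)).exists_lipschitzOnWith
    have hsrc' : ∀ᶠ σ in 𝓝 τ, γ σ ∈ φ.source :=
      (hγc τ hτ).eventually (φ.open_source.mem_nhds hτs)
    have heq := ODE_solution_unique_of_eventually (v := fun _ => geodesicField g φ)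
      (s := fun _ => V) (K := K) (t₀ := τ) (f := fun τ => (φ (γ τ), deriv (fun τ => φ (γ τ)) τ))
      (g := c) (Eventually.of_forall fun _ => hK)
      (by
        filter_upwards [isOpen_Ioo.mem_nhds hτ, hsrc',
          hd.continuousAt.eventually (hτe ▸ hV)] with σ hσ hσs hσV
        exact ⟨hγ.hasDerivAt g isOpen_Ioo hφ ((hmem σ).1 hσ).1 hσs, hσV⟩)
      (by
        filter_upwards [isOpen_Ioo.mem_nhds hτ, hcτ.1.continuousAt.eventually hV] with σ hσ hσV
        exact ⟨(hc σ ((hmem σ).1 hσ).2).1, hσV⟩) hτe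
    filter_upwards [isOpen_Ioo.mem_nhds hτ, hsrc', heq] with σ hσ hσs hσe
    exact ⟨hσ, hσs, hσe⟩
  have hsub : I ⊆ S := by
    refine isPreconnected_Ioo.subset_of_closure_inter_subset hopen
      ⟨0, (hmem 0).2 ⟨h0, h0'⟩, (hmem 0).2 ⟨h0, h0'⟩, hsrc, hinit.symm⟩ ?_
    rintro τ ⟨hτcl, hτ⟩
    have hfreq := mem_closure_iff_frequently.1 hτcl
    have hcτ := hc τ ((hmem τ).1 hτ).2
    -- At a limit point of `S`, positions agree first, by the Hausdorff property. This puts `γ τ` in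
    -- the chart domain, where velocities are continuous and agree in the limit too.
    have h1 : γ τ = φ.symm (c τ).1 := by
      have hcont : ContinuousAt (fun σ => φ.symm (c σ).1) τ :=
        ContinuousAt.comp (φ.continuousAt_symm hcτ.2)
          (continuous_fst.continuousAt.comp hcτ.1.continuousAt)
      refine tendsto_nhds_unique_of_frequently_eq (hγc τ hτ) hcont (hfreq.mono fun σ hσ => ?_)
      rw [← hσ.2.2]
      exact (φ.left_inv hσ.2.1).symm
    have hτs : γ τ ∈ φ.source := h1 ▸ φ.map_target hcτ.2
    have hd := hγ.hasDerivAt g isOpen_Ioo hφ ((hmem τ).1 hτ).1 hτs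
    exact ⟨hτ, hτs, tendsto_nhds_unique_of_frequently_eq hd.continuousAt hcτ.1.continuousAt
      (hfreq.mono fun σ hσ => hσ.2.2)⟩
  have h := hsub ((hmem t).2 ⟨ht, ht'⟩)
  rw [← h.2.2]
  exact (φ.left_inv h.2.1).symm

lemma geodesicField_curve_chart
    {c : ℝ → EuclideanSpace ℝ (Fin n) × EuclideanSpace ℝ (Fin n)} {s : Set ℝ} (hs : IsOpen s)
    (hc : ∀ t ∈ s, HasDerivAt c (geodesicField g φ (c t)) t ∧ (c t).1 ∈ φ.target)
    {t : ℝ} (ht : t ∈ s) :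
    (φ (φ.symm (c t).1), deriv (fun τ => φ (φ.symm (c τ).1)) t) = c t := by
  have h : (fun τ => φ (φ.symm (c τ).1)) =ᶠ[𝓝 t] fun τ => (c τ).1 := by
    filter_upwards [hs.mem_nhds ht] with τ hτ
    exact φ.right_inv (hc τ hτ).2
  rw [h.deriv_eq, φ.right_inv (hc t ht).2, (hasDerivAt_fst_comp (hc t ht).1).deriv]
  rfl

/-- The geodesic with given initial conditions is computed by the geodesic equation in a
coordinate system. -/
lemma geodesicPoint_eq [T2Space M] (hφ : φ ∈ charts n M)
    {c : ℝ → EuclideanSpace ℝ (Fin n) × EuclideanSpace ℝ (Fin n)} {a b : ℝ}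
    (hc : ∀ t ∈ Ioo a b, HasDerivAt c (geodesicField g φ (c t)) t ∧ (c t).1 ∈ φ.target)
    (h0 : 0 ∈ Ioo a b) {p : M} (hp : p ∈ φ.source) {η : TangentSpace (𝓡 n) p}
    (hinit : c 0 = (φ p, chartDeriv φ p η)) {t : ℝ} (ht : t ∈ Ioo a b) :
    geodesicPoint g p η t = φ.symm (c t).1 := by
  have hgeo := isGeodesicOn_of_geodesicField g hφ isOpen_Ioo hc
  have hγ0 : φ.symm (c 0).1 = p := by rw [hinit]; exact φ.left_inv hp
  have hreach : ReachedByGeodesic g p η t (φ.symm (c t).1) := by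
    refine ⟨fun t => φ.symm (c t).1, a, b, h0, ht, hgeo, ?_, rfl⟩
    refine (tangentMap_eq_iff ((hgeo.1.contMDiffAt (isOpen_Ioo.mem_nhds h0)).mdifferentiableAt
      (by simp)) hφ hp η).2 ⟨hγ0, ?_⟩
    have := congrArg Prod.snd (geodesicField_curve_chart g isOpen_Ioo hc h0)
    rw [hinit] at this
    exact this
  have hex : ∃ q, ReachedByGeodesic g p η t q := ⟨_, hreach⟩
  rw [geodesicPoint, dif_pos hex]
  -- The chosen point comes from some geodesic `γ`, possibly leaving the chart a priori; uniqueness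
  -- forces it to follow `c`.
  obtain ⟨γ, a', b', h0', ht', hγ, htan, hq⟩ := hex.choose_spec
  rw [← hq]
  have hi := (tangentMap_eq_iff ((hγ.1.contMDiffAt (isOpen_Ioo.mem_nhds h0')).mdifferentiableAt
      (by simp)) hφ hp η).1 htan
  refine hγ.eq_of_geodesicField g hφ hc h0' h0 (hi.1 ▸ hp) ?_ ht' ht
  rw [hi.1, hi.2, hinit]

end Uniqueness

/-! ### Derivatives of a function along a geodesic. -/

section SecondDerivative

/-- The covariant Hessian of `f` in the coordinate system `φ`, as a quadratic form in the
velocity. -/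
noncomputable def chartHessian (φ : OpenPartialHomeomorph M (EuclideanSpace ℝ (Fin n))) (f : M → ℝ)
    (z : EuclideanSpace ℝ (Fin n) × EuclideanSpace ℝ (Fin n)) : ℝ :=
  fderiv ℝ (fderiv ℝ fun y => f (φ.symm y)) z.1 z.2 z.2
    - fderiv ℝ (fun y => f (φ.symm y)) z.1 (christoffelVec g φ z.1 z.2)

variable {f : M → ℝ}

lemma contDiffOn_comp_chart_symm (hf : ContMDiff (𝓡 n) 𝓘(ℝ, ℝ) ∞ f)
    (hφ : φ ∈ charts n M) :
    ContDiffOn ℝ ∞ (fun y => f (φ.symm y)) φ.target := by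
  rw [← contMDiffOn_iff_contDiffOn]
  exact hf.comp_contMDiffOn (contMDiffOn_symm_of_mem_maximalAtlas hφ)

lemma contDiffAt_chartHessian (hf : ContMDiff (𝓡 n) 𝓘(ℝ, ℝ) ∞ f) (hφ : φ ∈ charts n M)
    {z : EuclideanSpace ℝ (Fin n) × EuclideanSpace ℝ (Fin n)} (hz : z.1 ∈ φ.target) :
    ContDiffAt ℝ ∞ (chartHessian g φ f) z := by
  have hF := contDiffOn_comp_chart_symm hf hφ
  have h1 := hF.fderiv_of_isOpen (m := ∞) φ.open_target (by simp)
  have h2 := h1.fderiv_of_isOpen (m := ∞) φ.open_target (by simp)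
  have hΓ : ContDiffAt ℝ ∞ (fun z : EuclideanSpace ℝ (Fin n) × EuclideanSpace ℝ (Fin n) =>
      christoffelVec g φ z.1 z.2) z := (contDiffOn_christoffelVec g hφ).contDiffAt
    ((φ.open_target.prod isOpen_univ).mem_nhds ⟨hz, trivial⟩)
  have h1' := (h1.contDiffAt (φ.open_target.mem_nhds hz)).comp z contDiffAt_fst
  have h2' := (h2.contDiffAt (φ.open_target.mem_nhds hz)).comp z contDiffAt_fst
  exact ((h2'.clm_apply contDiffAt_snd).clm_apply contDiffAt_snd).sub (h1'.clm_apply hΓ)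

/-- First and second derivative of a function along a geodesic. -/
lemma IsGeodesicOn.hasDerivAt_comp (hf : ContMDiff (𝓡 n) 𝓘(ℝ, ℝ) ∞ f)
    {γ : ℝ → M} {s : Set ℝ} (hγ : IsGeodesicOn g γ s)
    (hs : IsOpen s) (hφ : φ ∈ charts n M) {t : ℝ} (ht : t ∈ s) (hsrc : γ t ∈ φ.source) :
    HasDerivAt (fun τ => f (γ τ))
      (fderiv ℝ (fun y => f (φ.symm y)) (φ (γ t)) (deriv (fun τ => φ (γ τ)) t)) t ∧
    HasDerivAt (deriv fun τ => f (γ τ))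
      (chartHessian g φ f (φ (γ t), deriv (fun τ => φ (γ τ)) t)) t := by
  have hcont : ContinuousAt γ t := hγ.1.continuousOn.continuousAt (hs.mem_nhds ht)
  have hev : ∀ᶠ τ in 𝓝 t, τ ∈ s ∧ γ τ ∈ φ.source :=
    (hs.eventually_mem ht).and (hcont.eventually (φ.open_source.mem_nhds hsrc))
  have hF : ∀ τ, γ τ ∈ φ.source → ContDiffAt ℝ ∞ (fun y => f (φ.symm y)) (φ (γ τ)) := fun τ hτ =>
    (contDiffOn_comp_chart_symm hf hφ).contDiffAt (φ.open_target.mem_nhds (φ.map_source hτ))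
  have h₁ : ∀ τ, τ ∈ s → γ τ ∈ φ.source → HasDerivAt (fun τ => f (γ τ))
      (fderiv ℝ (fun y => f (φ.symm y)) (φ (γ τ)) (deriv (fun τ => φ (γ τ)) τ)) τ := by
    intro τ hτ hτs
    have hd := hasDerivAt_fst_comp (hγ.hasDerivAt g hs hφ hτ hτs)
    have h := ((hF τ hτs).differentiableAt (by simp)).hasFDerivAt.comp_hasDerivAt τ hd
    refine h.congr_of_eventuallyEq ?_
    filter_upwards [(hγ.1.continuousOn.continuousAt (hs.mem_nhds hτ)).eventually
      (φ.open_source.mem_nhds hτs)] with σ hσ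
    simp [φ.left_inv hσ]
  refine ⟨h₁ t ht hsrc, ?_⟩
  have hd := hγ.hasDerivAt g hs hφ ht hsrc
  -- The chain rule gives `D²F(v, v) + DF(a)`; inserting `a = -Γ(v, v)` yields `chartHessian`.
  have h₂ := hasDerivAt_fderiv_comp ((hF t hsrc).of_le (by norm_cast))
    (hasDerivAt_fst_comp hd) (hasDerivAt_snd_comp hd)
  have h₃ : (deriv fun τ => f (γ τ)) =ᶠ[𝓝 t] fun τ =>
      fderiv ℝ (fun y => f (φ.symm y)) (φ (γ τ)) (deriv (fun τ => φ (γ τ)) τ) :=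
    hev.mono fun τ hτ => (h₁ τ hτ.1 hτ.2).deriv
  refine (h₂.congr_of_eventuallyEq h₃).congr_deriv ?_
  simp [chartHessian, geodesicField, sub_eq_add_neg]

end SecondDerivative

end GeodesicWalk

/-! ### Geodesic flow for uniformly bounded velocities. -/

namespace GeodesicWalk

variable {n : ℕ} {M : Type*} [TopologicalSpace M]
  [ChartedSpace (EuclideanSpace ℝ (Fin n)) M] [IsManifold (𝓡 n) ∞ M]
  (g : Metric n M) {φ : OpenPartialHomeomorph M (EuclideanSpace ℝ (Fin n))}

section UniformFlow

/-- This homogeneity is what allows slow geodesics to be run faster for a shorter time. -/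
lemma christoffelVec_smul (y v : EuclideanSpace ℝ (Fin n)) (s : ℝ) :
    christoffelVec g φ y (s • v) = s ^ 2 • christoffelVec g φ y v := by
  ext k
  simp only [christoffelVec, PiLp.smul_apply, smul_eq_mul, Finset.mul_sum]
  exact Finset.sum_congr rfl fun i _ => Finset.sum_congr rfl fun j _ => by ring

lemma chartHessian_smul (f : M → ℝ) (y v : EuclideanSpace ℝ (Fin n)) (s : ℝ) :
    chartHessian g φ f (y, s • v) = s ^ 2 * chartHessian g φ f (y, v) := by
  simp only [chartHessian, christoffelVec_smul, map_smul, _root_.smul_apply, smul_eq_mul]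
  ring

/-- Rescaling time and velocity preserves solutions of the geodesic equation. -/
lemma hasDerivAt_geodesicField_rescale
    {c : ℝ → EuclideanSpace ℝ (Fin n) × EuclideanSpace ℝ (Fin n)} {s t : ℝ}
    (hc : HasDerivAt c (geodesicField g φ (c (s⁻¹ * t))) (s⁻¹ * t)) :
    HasDerivAt (fun t => ((c (s⁻¹ * t)).1, s⁻¹ • (c (s⁻¹ * t)).2))
      (geodesicField g φ ((c (s⁻¹ * t)).1, s⁻¹ • (c (s⁻¹ * t)).2)) t := by
  have hlin : HasDerivAt (fun t : ℝ => s⁻¹ * t) s⁻¹ t := by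
    simpa using (hasDerivAt_id t).const_mul s⁻¹
  have h1 := (hasDerivAt_fst_comp hc).scomp t hlin
  have h2 := ((hasDerivAt_snd_comp hc).scomp t hlin).const_smul s⁻¹
  refine (h1.prodMk h2).congr_deriv ?_
  simp only [geodesicField, christoffelVec_smul, smul_neg, smul_smul, sq]

/-- Uniform existence of solutions of the geodesic equation in a coordinate system, for initial
positions near `y₀` and initial velocities bounded by `R`. -/
lemma exists_uniform_geodesicFlow (hφ : φ ∈ charts n M) {y₀ : EuclideanSpace ℝ (Fin n)}
    (hy₀ : y₀ ∈ φ.target) {R : ℝ} (hR : 0 ≤ R)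
    {U : Set (EuclideanSpace ℝ (Fin n) × EuclideanSpace ℝ (Fin n))} (hU : U ∈ 𝓝 (y₀, 0)) :
    ∃ r > (0 : ℝ), ∃ s > (0 : ℝ), ∃ T > (0 : ℝ), ∃ L ≥ (0 : ℝ),
      ∃ β : EuclideanSpace ℝ (Fin n) × EuclideanSpace ℝ (Fin n) → ℝ →
        EuclideanSpace ℝ (Fin n) × EuclideanSpace ℝ (Fin n),
      (∀ z ∈ Metric.closedBall y₀ r ×ˢ Metric.closedBall 0 R, β z 0 = z ∧ ∀ t ∈ Ioo (-T) T,
        (HasDerivAt (β z) (geodesicField g φ (β z t)) t ∧ (β z t).1 ∈ φ.target) ∧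
        ((β z t).1, s • (β z t).2) ∈ U ∧
        ‖((β z t).1, s • (β z t).2) - (z.1, s • z.2)‖ ≤ L * |t|) ∧
      ∀ t ∈ Ioo (-T) T, ContinuousOn (fun z => β z t)
        (Metric.closedBall y₀ r ×ˢ Metric.closedBall 0 R) := by
  have hU' : U ∩ {z | z.1 ∈ φ.target} ∈ 𝓝 (y₀, (0 : EuclideanSpace ℝ (Fin n))) :=
    inter_mem hU (continuous_fst.continuousAt.preimage_mem_nhds (φ.open_target.mem_nhds hy₀))
  obtain ⟨r, hr, ε, hε, L, hL, α, hα, hcont⟩ := exists_localFlow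
    ((contDiffAt_geodesicField g hφ (z := (y₀, 0)) hy₀).of_le (m := 1) (by norm_cast))
    hU'
  -- Scaling by `s` moves velocities of norm at most `R` into the ball of radius `r` where the local
  -- flow exists; the `+ 1` covers `R = 0`. Existence time shrinks to `s * ε`.
  set s := r / (R + 1) with hs
  have hs0 : 0 < s := by positivity
  have hsR : s * R ≤ r := by
    rw [hs, div_mul_eq_mul_div, div_le_iff₀ (by positivity)]
    nlinarith
  have hmem : ∀ z ∈ Metric.closedBall y₀ r ×ˢ Metric.closedBall (0 : EuclideanSpace ℝ (Fin n)) R,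
      (z.1, s • z.2) ∈ Metric.closedBall (y₀, (0 : EuclideanSpace ℝ (Fin n))) r := by
    rintro ⟨y, v⟩ ⟨hy, hv⟩
    rw [Metric.mem_closedBall, Prod.dist_eq, max_le_iff]
    refine ⟨hy, ?_⟩
    simp only [mem_closedBall_zero_iff] at hv
    simp only [dist_zero_right, norm_smul, Real.norm_eq_abs, abs_of_pos hs0]
    exact (mul_le_mul_of_nonneg_left hv hs0.le).trans hsR
  have htime : ∀ t ∈ Ioo (-(s * ε)) (s * ε), s⁻¹ * t ∈ Ioo (-ε) ε := by
    intro t ht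
    rw [mem_Ioo, ← abs_lt] at ht ⊢
    rw [abs_mul, abs_of_pos (inv_pos.2 hs0), inv_mul_lt_iff₀ hs0]
    exact ht
  refine ⟨r, hr, s, hs0, s * ε, by positivity, L * s⁻¹, by positivity,
    fun z t => ((α (z.1, s • z.2) (s⁻¹ * t)).1, s⁻¹ • (α (z.1, s • z.2) (s⁻¹ * t)).2),
    fun z hz => ⟨?_, fun t ht => ?_⟩, fun t ht => ?_⟩
  · simp [(hα _ (hmem z hz)).1, smul_smul, inv_mul_cancel₀ hs0.ne']
  · obtain ⟨h1, h2, h3⟩ := (hα _ (hmem z hz)).2 _ (htime t ht)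
    refine ⟨⟨hasDerivAt_geodesicField_rescale g h1, h2.2⟩, ?_⟩
    simp only [smul_smul, mul_inv_cancel₀ hs0.ne', one_smul]
    refine ⟨h2.1, h3.trans (le_of_eq ?_)⟩
    rw [abs_mul, abs_of_pos (inv_pos.2 hs0)]
    ring
  · have h1 : ContinuousOn (fun z : EuclideanSpace ℝ (Fin n) × EuclideanSpace ℝ (Fin n) =>
        α (z.1, s • z.2) (s⁻¹ * t)) (Metric.closedBall y₀ r ×ˢ Metric.closedBall 0 R) :=
      (hcont _ (htime t ht)).comp (by fun_prop) hmem
    exact (continuous_fst.comp_continuousOn h1).prodMk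
      ((continuous_snd.comp_continuousOn h1).const_smul s⁻¹)

end UniformFlow

section NormComparison

/-- On the compact product of a closed ball and the unit sphere the metric form is bounded below by
some `m > 0`, so `m * ‖u‖ ^ 2 ≤ g(η, η)`. -/
lemma exists_norm_chartDeriv_le (hφ : φ ∈ charts n M) {y₀ : EuclideanSpace ℝ (Fin n)}
    (hy₀ : y₀ ∈ φ.target) (K : ℝ) :
    ∃ r > (0 : ℝ), ∃ R ≥ (0 : ℝ), ∀ p ∈ φ.source, φ p ∈ Metric.closedBall y₀ r →
      ∀ η : TangentSpace (𝓡 n) p, tangentNorm g p η ≤ K → ‖chartDeriv φ p η‖ ≤ R := by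
  obtain ⟨r, hr, hball⟩ := Metric.nhds_basis_closedBall.mem_iff.1 (φ.open_target.mem_nhds hy₀)
  have hcomp : IsCompact (Metric.closedBall y₀ r ×ˢ
      Metric.sphere (0 : EuclideanSpace ℝ (Fin n)) 1) :=
    (isCompact_closedBall y₀ r).prod (isCompact_sphere 0 1)
  have hcont : ContinuousOn (fun z : EuclideanSpace ℝ (Fin n) × EuclideanSpace ℝ (Fin n) =>
      metricForm g φ z.1 z.2 z.2) (Metric.closedBall y₀ r ×ˢ Metric.sphere 0 1) := by
    have h1 : ContinuousOn (fun z : EuclideanSpace ℝ (Fin n) × EuclideanSpace ℝ (Fin n) =>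
        metricForm g φ z.1) (Metric.closedBall y₀ r ×ˢ Metric.sphere 0 1) :=
      (continuousOn_metricForm g hφ).comp continuousOn_fst fun z hz => hball hz.1
    exact (h1.clm_apply continuousOn_snd).clm_apply continuousOn_snd
  obtain ⟨m, hm, hmle⟩ := hcomp.exists_forall_le' hcont (a := 0) (by
    rintro ⟨y, u⟩ ⟨hy, hu⟩
    refine metricForm_pos g hφ (hball hy) fun h => ?_
    obtain rfl : u = 0 := h
    simp at hu)
  -- The absolute value keeps the bound nonnegative whatever the sign of `K`.
  refine ⟨r, hr, |K| / Real.sqrt m, by positivity, fun p hp hpr η hη => ?_⟩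
  set u := chartDeriv φ p η with hu
  have hmu : m * ‖u‖ ^ 2 ≤ g.inner p η η := by
    rw [inner_eq_metricForm g hφ hp, ← hu]
    by_cases h0 : u = 0
    · simp [h0]
    have hn : ‖u‖ ≠ 0 := norm_ne_zero_iff.2 h0
    have h1 := hmle (φ p, ‖u‖⁻¹ • u) ⟨hpr, by simp [norm_smul, hn]⟩
    simp only [map_smul, _root_.smul_apply, smul_eq_mul] at h1
    calc m * ‖u‖ ^ 2 ≤ ‖u‖⁻¹ * (‖u‖⁻¹ * metricForm g φ (φ p) u u) * ‖u‖ ^ 2 := by gcongr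
      _ = metricForm g φ (φ p) u u := by field_simp
  rw [le_div_iff₀ (Real.sqrt_pos.2 hm)]
  calc ‖u‖ * Real.sqrt m = Real.sqrt (m * ‖u‖ ^ 2) := by
        rw [Real.sqrt_mul hm.le, Real.sqrt_sq (norm_nonneg _), mul_comm]
    _ ≤ Real.sqrt (g.inner p η η) := Real.sqrt_le_sqrt hmu
    _ ≤ K := hη
    _ ≤ |K| := le_abs_self K

end NormComparison

/-! ### Uniform second order expansion along geodesics. -/

section UniformTaylor

/-- Second order expansion of `f` along the geodesics that start in `S` with speed at most `K`,
uniform in the initial conditions. -/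
def HasUniformExpansion (f : M → ℝ) (K : ℝ) (S : Set M) : Prop :=
  ∃ T > (0 : ℝ), ∃ C ≥ (0 : ℝ), ∀ p ∈ S, ∀ h ∈ Ioo 0 T,
    ContinuousOn (fun η => f (geodesicPoint g p η h)) {η | tangentNorm g p η ≤ K} ∧
    ∀ φ ∈ charts n M, p ∈ φ.source → ∀ η : TangentSpace (𝓡 n) p, tangentNorm g p η ≤ K →
      |f (geodesicPoint g p η h) - f p
        - h * fderiv ℝ (fun y => f (φ.symm y)) (φ p) (chartDeriv φ p η)
        - h ^ 2 / 2 * chartHessian g φ f (φ p, chartDeriv φ p η)| ≤ C * h ^ 3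

/-- The flow is solved in the chart at `p₀`, where the Hessian is Lipschitz near zero velocity; the
coefficients of the expansion may be read in any chart around `p`. -/
lemma exists_nhds_hasUniformExpansion [T2Space M] {f : M → ℝ}
    (hf : ContMDiff (𝓡 n) 𝓘(ℝ, ℝ) ∞ f) (K : ℝ) (p₀ : M) :
    ∃ W ∈ 𝓝 p₀, HasUniformExpansion g f K W := by
  set φ := chartAt (EuclideanSpace ℝ (Fin n)) p₀ with hφdef
  have hφ : φ ∈ charts n M := IsManifold.chart_mem_maximalAtlas p₀
  have hp₀ : p₀ ∈ φ.source := mem_chart_source _ p₀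
  have hy₀ : φ p₀ ∈ φ.target := φ.map_source hp₀
  obtain ⟨r₁, hr₁, R, hR, hbound⟩ := exists_norm_chartDeriv_le g hφ hy₀ K
  obtain ⟨KH, U, hU, hKH⟩ := ((contDiffAt_chartHessian g hf hφ (z := (φ p₀, 0)) hy₀).of_le
    (m := 1) (by norm_cast)).exists_lipschitzOnWith
  obtain ⟨r, hr, s, hs, T, hT, L, hL, β, hβ, hβc⟩ := exists_uniform_geodesicFlow g hφ hy₀ hR hU
  have hW : φ.source ∩ φ ⁻¹' Metric.closedBall (φ p₀) (min r r₁) ∈ 𝓝 p₀ :=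
    inter_mem (φ.open_source.mem_nhds hp₀) ((φ.continuousAt hp₀).preimage_mem_nhds
      (Metric.closedBall_mem_nhds _ (lt_min hr hr₁)))
  -- `KH` is the Lipschitz constant of the Hessian on `U` and `L` bounds the displacement of the
  -- rescaled flow per unit time; `(s ^ 2)⁻¹` undoes the velocity scaling, the Hessian being
  -- quadratic.
  refine ⟨_, hW, T, hT, (s ^ 2)⁻¹ * (KH * L), by positivity, ?_⟩
  rintro p ⟨hp, hpr⟩ h ⟨hh0, hhT⟩
  have hz : ∀ η : TangentSpace (𝓡 n) p, tangentNorm g p η ≤ K → (φ p, chartDeriv φ p η) ∈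
      Metric.closedBall (φ p₀) r ×ˢ Metric.closedBall (0 : EuclideanSpace ℝ (Fin n)) R := by
    intro η hη
    refine ⟨Metric.closedBall_subset_closedBall (min_le_left _ _) hpr, ?_⟩
    rw [mem_closedBall_zero_iff]
    exact hbound p hp (Metric.closedBall_subset_closedBall (min_le_right _ _) hpr) η hη
  have h0T : (0 : ℝ) ∈ Ioo (-T) T := ⟨by linarith, hT⟩
  have hhT' : h ∈ Ioo (-T) T := ⟨by linarith, hhT⟩
  have hpt : ∀ η : TangentSpace (𝓡 n) p, tangentNorm g p η ≤ K →
      geodesicPoint g p η h = φ.symm (β (φ p, chartDeriv φ p η) h).1 := fun η hη =>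
    geodesicPoint_eq g hφ (fun t ht => ((hβ _ (hz η hη)).2 t ht).1) h0T hp (hβ _ (hz η hη)).1 hhT'
  refine ⟨?_, fun φ' hφ' hp' η hη => ?_⟩
  · have h1 : ContinuousOn (fun η : TangentSpace (𝓡 n) p => β (φ p, chartDeriv φ p η) h)
        {η | tangentNorm g p η ≤ K} :=
      (hβc h hhT').comp (continuous_const.prodMk (chartDeriv φ p).continuous).continuousOn hz
    have h2 : ContinuousOn
        (fun η : TangentSpace (𝓡 n) p => φ.symm (β (φ p, chartDeriv φ p η) h).1)
        {η | tangentNorm g p η ≤ K} :=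
      φ.continuousOn_symm.comp (continuous_fst.comp_continuousOn h1)
        fun η hη => (((hβ _ (hz η hη)).2 h hhT').1).2
    exact (hf.continuous.comp_continuousOn h2).congr fun η hη => congrArg f (hpt η hη)
  · set z := (φ p, chartDeriv φ p η) with hzdef
    have hβz := hβ z (hz η hη)
    have hsol : ∀ t ∈ Ioo (-T) T, HasDerivAt (β z) (geodesicField g φ (β z t)) t ∧
      (β z t).1 ∈ φ.target := fun t ht => (hβz.2 t ht).1
    have hgeo := isGeodesicOn_of_geodesicField g hφ isOpen_Ioo hsol
    set γ := fun t => φ.symm (β z t).1 with hγ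
    have hγ0 : γ 0 = p := by
      simp only [hγ, hβz.1]
      exact φ.left_inv hp
    have hmd : MDifferentiableAt 𝓘(ℝ, ℝ) (𝓡 n) γ 0 :=
      (hgeo.1.contMDiffAt (isOpen_Ioo.mem_nhds h0T)).mdifferentiableAt (by simp)
    have hchart : ∀ t ∈ Ioo (-T) T, (φ (γ t), deriv (fun τ => φ (γ τ)) t) = β z t :=
      fun t ht => geodesicField_curve_chart g isOpen_Ioo hsol ht
    have htan : tangentMap 𝓘(ℝ, ℝ) (𝓡 n) γ ⟨0, (1 : ℝ)⟩ = ⟨p, η⟩ := by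
      refine (tangentMap_eq_iff hmd hφ hp η).2 ⟨hγ0, ?_⟩
      have := congrArg Prod.snd (hchart 0 h0T)
      rw [hβz.1] at this
      exact this
    have hinit := ((tangentMap_eq_iff hmd hφ' hp' η).1 htan).2
    have hder : ∀ t ∈ Ioo (-T) T, HasDerivAt (fun τ => f (γ τ)) (deriv (fun τ => f (γ τ)) t) t ∧
        HasDerivAt (deriv fun τ => f (γ τ)) (chartHessian g φ f (β z t)) t := by
      intro t ht
      have h1 := hgeo.hasDerivAt_comp g hf isOpen_Ioo hφ ht (φ.map_target (hsol t ht).2)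
      rw [hchart t ht] at h1
      exact ⟨h1.1.differentiableAt.hasDerivAt, h1.2⟩
    -- The derivatives at `0` are also computed in `φ'`; uniqueness of derivatives transfers the
    -- expansion from `φ` to `φ'`.
    have h0' := hgeo.hasDerivAt_comp g hf isOpen_Ioo hφ' h0T (hγ0 ▸ hp')
    rw [hγ0, hinit] at h0'
    have hsubT : ∀ t ∈ Icc 0 h, t ∈ Ioo (-T) T := fun t ht => ⟨by linarith [ht.1], by
      linarith [ht.2]⟩
    have hscale : ∀ t ∈ Ioo (-T) T, chartHessian g φ f (β z t) =
        (s ^ 2)⁻¹ * chartHessian g φ f ((β z t).1, s • (β z t).2) := by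
      intro t _
      rw [chartHessian_smul, ← mul_assoc, inv_mul_cancel₀ (by positivity), one_mul]
    have hLip : ∀ t ∈ Icc 0 h, |chartHessian g φ f (β z t) - chartHessian g φ f (β z 0)| ≤
        (s ^ 2)⁻¹ * (KH * L) * t := by
      intro t ht
      have hz0 := (hβz.2 0 h0T).2.1
      have hzt := (hβz.2 t (hsubT t ht)).2
      have h1 := hKH.dist_le_mul _ hzt.1 _ hz0
      rw [Real.dist_eq, dist_eq_norm, hβz.1] at h1
      rw [hscale t (hsubT t ht), hscale 0 h0T, ← mul_sub, abs_mul,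
        abs_of_pos (by positivity : 0 < (s ^ 2)⁻¹), mul_assoc, hβz.1]
      refine mul_le_mul_of_nonneg_left ?_ (by positivity)
      calc _ ≤ _ := h1
        _ ≤ KH * (L * |t|) := by gcongr; exact hzt.2
        _ = KH * L * t := by rw [abs_of_nonneg ht.1]; ring
    have hT2 := abs_taylor_two_le hh0.le (by positivity : 0 ≤ (s ^ 2)⁻¹ * (KH * L))
      (fun t ht => (hder t (hsubT t ht)).1) (fun t ht => (hder t (hsubT t ht)).2) hLip
    rw [h0'.1.deriv, (hder 0 h0T).2.unique h0'.2, hγ0] at hT2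
    rw [hpt η hη]
    exact hT2

/-- The property passes to subsets and to finite unions (smaller `T`, larger `C`) and holds locally,
so compactness gives it globally. -/
lemma hasUniformExpansion_univ [T2Space M] [CompactSpace M] {f : M → ℝ}
    (hf : ContMDiff (𝓡 n) 𝓘(ℝ, ℝ) ∞ f) (K : ℝ) : HasUniformExpansion g f K univ := by
  refine isCompact_univ.induction_on (p := HasUniformExpansion g f K)
    ⟨1, one_pos, 0, le_rfl, by simp⟩ ?_ ?_ fun p _ => ?_
  · rintro S S' hSS' ⟨T, hT, C, hC, h⟩
    exact ⟨T, hT, C, hC, fun p hp => h p (hSS' hp)⟩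
  · rintro S S' ⟨T, hT, C, hC, h⟩ ⟨T', hT', C', hC', h'⟩
    refine ⟨min T T', lt_min hT hT', max C C', le_max_of_le_left hC, fun p hp t ht => ?_⟩
    have ht3 : 0 ≤ t ^ 3 := pow_nonneg ht.1.le 3
    rcases hp with hp | hp
    · have h1 := h p hp t ⟨ht.1, ht.2.trans_le (min_le_left _ _)⟩
      exact ⟨h1.1, fun φ hφ hpφ η hη => (h1.2 φ hφ hpφ η hη).trans
        (mul_le_mul_of_nonneg_right (le_max_left _ _) ht3)⟩
    · have h1 := h' p hp t ⟨ht.1, ht.2.trans_le (min_le_right _ _)⟩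
      exact ⟨h1.1, fun φ hφ hpφ η hη => (h1.2 φ hφ hpφ η hη).trans
        (mul_le_mul_of_nonneg_right (le_max_right _ _) ht3)⟩
  · obtain ⟨W, hW, h⟩ := exists_nhds_hasUniformExpansion g hf K p
    exact ⟨W, by simpa using hW, h⟩

end UniformTaylor

end GeodesicWalk

/-! ### Integration of the expansion and the limit. -/

namespace GeodesicWalk

variable {n : ℕ} {M : Type*} [TopologicalSpace M]
  [ChartedSpace (EuclideanSpace ℝ (Fin n)) M] [IsManifold (𝓡 n) ∞ M]
  (g : Metric n M) {φ : OpenPartialHomeomorph M (EuclideanSpace ℝ (Fin n))}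

section Moments

/-- Isolating the products `v i * v j` lets the second moments be substituted under the integral. -/
lemma chartHessian_eq_sum {f : M → ℝ} (hf : ContMDiff (𝓡 n) 𝓘(ℝ, ℝ) ∞ f) (hφ : φ ∈ charts n M)
    {y : EuclideanSpace ℝ (Fin n)} (hy : y ∈ φ.target) (v : EuclideanSpace ℝ (Fin n)) :
    chartHessian g φ f (y, v) = ∑ i, ∑ j, v i * v j *
      (partialDeriv i (partialDeriv j fun y => f (φ.symm y)) y
        - ∑ k, christoffel g φ k i j y * partialDeriv k (fun y => f (φ.symm y)) y) := by
  set F := fun y => f (φ.symm y) with hF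
  have hF2 : DifferentiableAt ℝ (fderiv ℝ F) y :=
    ((((contDiffOn_comp_chart_symm hf hφ).fderiv_of_isOpen (m := ∞) φ.open_target
      (by simp)).contDiffAt (φ.open_target.mem_nhds hy)).differentiableAt (by simp))
  have hpp : ∀ i j, partialDeriv i (partialDeriv j F) y = fderiv ℝ (fderiv ℝ F) y
      (EuclideanSpace.single i 1) (EuclideanSpace.single j 1) := by
    intro i j
    have h : HasFDerivAt (fun y => fderiv ℝ F y (EuclideanSpace.single j 1)) _ y :=
      hF2.hasFDerivAt.clm_apply (hasFDerivAt_const _ y)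
    refine (congrArg (fun T => T (EuclideanSpace.single i 1)) h.fderiv).trans ?_
    simp
  have h1 : fderiv ℝ (fderiv ℝ F) y v v =
      ∑ i, ∑ j, v i * v j * partialDeriv i (partialDeriv j F) y := by
    simp only [hpp]
    have h := bilinear_eq_sum (LinearMap.mk₂ ℝ (fun u w => fderiv ℝ (fderiv ℝ F) y u w)
      (by simp) (by simp) (by simp) (by simp)) LinearMap.id v v
    refine h.trans (Finset.sum_congr rfl fun i _ => Finset.sum_congr rfl fun j _ => ?_)
    simp only [LinearMap.mk₂_apply, LinearMap.id_apply]
    ring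
  have h2 : fderiv ℝ F y (christoffelVec g φ y v) =
      ∑ i, ∑ j, v i * v j * ∑ k, christoffel g φ k i j y * partialDeriv k F y := by
    rw [fderiv_eq_sum_partialDeriv]
    simp only [christoffelVec, Finset.sum_mul, Finset.mul_sum]
    rw [Finset.sum_comm]
    refine Finset.sum_congr rfl fun i _ => ?_
    rw [Finset.sum_comm]
    exact Finset.sum_congr rfl fun j _ => Finset.sum_congr rfl fun k _ => by ring
  simp only [chartHessian, ← hF, h1, h2, mul_sub, Finset.sum_sub_distrib]

variable {p : M} {ν : Measure (TangentSpace (𝓡 n) p)} [IsFiniteMeasure ν] {K : ℝ}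

/-- The tangent space is second countable, so the support has full measure. -/
lemma ae_tangentNorm_le (hsupp : ∀ η ∈ ν.support, tangentNorm g p η ≤ K) :
    ∀ᵐ η ∂ν, tangentNorm g p η ≤ K := by
  have : SecondCountableTopology (TangentSpace (𝓡 n) p) :=
    inferInstanceAs (SecondCountableTopology (EuclideanSpace ℝ (Fin n)))
  filter_upwards [Measure.support_mem_ae (μ := ν)] with η hη using hsupp η hη

lemma continuous_tangentNorm : Continuous (tangentNorm g p) := by
  have hφ : chartAt (EuclideanSpace ℝ (Fin n)) p ∈ charts n M :=
    IsManifold.chart_mem_maximalAtlas p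
  have hd := (chartDeriv (chartAt (EuclideanSpace ℝ (Fin n)) p) p).continuous
  refine (Real.continuous_sqrt.comp (((metricForm g (chartAt (EuclideanSpace ℝ (Fin n)) p)
    (chartAt (EuclideanSpace ℝ (Fin n)) p p)).continuous.comp hd).clm_apply hd)).congr fun η => ?_
  exact congrArg Real.sqrt (inner_eq_metricForm g hφ (mem_chart_source _ p) η η).symm

lemma exists_ae_norm_chartDeriv_le (hφ : φ ∈ charts n M) (hp : p ∈ φ.source)
    (hae : ∀ᵐ η ∂ν, tangentNorm g p η ≤ K) : ∃ R ≥ 0, ∀ᵐ η ∂ν, ‖chartDeriv φ p η‖ ≤ R := by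
  obtain ⟨r, hr, R, hR, h⟩ := exists_norm_chartDeriv_le g hφ (φ.map_source hp) K
  exact ⟨R, hR, hae.mono fun η hη => h p hp (Metric.mem_closedBall_self hr.le) η hη⟩

lemma continuous_component (i : Fin n) : Continuous fun η => component φ p η i :=
  (EuclideanSpace.proj i : EuclideanSpace ℝ (Fin n) →L[ℝ] ℝ).continuous.comp
    (chartDeriv φ p).continuous

lemma integrable_component (hφ : φ ∈ charts n M) (hp : p ∈ φ.source)
    (hae : ∀ᵐ η ∂ν, tangentNorm g p η ≤ K) (i : Fin n) :
    Integrable (fun η => component φ p η i) ν := by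
  obtain ⟨R, hR, h⟩ := exists_ae_norm_chartDeriv_le g hφ hp hae
  exact Integrable.of_bound (continuous_component i).aestronglyMeasurable R
    (h.mono fun η hη => (PiLp.norm_apply_le (chartDeriv φ p η) i).trans hη)

lemma integrable_component_mul (hφ : φ ∈ charts n M) (hp : p ∈ φ.source)
    (hae : ∀ᵐ η ∂ν, tangentNorm g p η ≤ K) (i j : Fin n) :
    Integrable (fun η => component φ p η i * component φ p η j) ν := by
  obtain ⟨R, hR, h⟩ := exists_ae_norm_chartDeriv_le g hφ hp hae
  refine Integrable.of_bound
    ((continuous_component i).mul (continuous_component j)).aestronglyMeasurable (R * R)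
    (h.mono fun η hη => ?_)
  rw [norm_mul]
  exact mul_le_mul ((PiLp.norm_apply_le (chartDeriv φ p η) i).trans hη)
    ((PiLp.norm_apply_le (chartDeriv φ p η) j).trans hη) (norm_nonneg _) hR

lemma integral_fderiv_chartDeriv (hφ : φ ∈ charts n M) (hp : p ∈ φ.source)
    (hae : ∀ᵐ η ∂ν, tangentNorm g p η ≤ K)
    (hmean : ∀ i, ∫ η, component φ p η i ∂ν = 0) (F : EuclideanSpace ℝ (Fin n) → ℝ) :
    Integrable (fun η => fderiv ℝ F (φ p) (chartDeriv φ p η)) ν ∧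
      ∫ η, fderiv ℝ F (φ p) (chartDeriv φ p η) ∂ν = 0 := by
  simp only [fderiv_eq_sum_partialDeriv, ← component_eq_chartDeriv]
  have hint : ∀ i, Integrable (fun η => component φ p η i * partialDeriv i F (φ p)) ν :=
    fun i => (integrable_component g hφ hp hae i).mul_const _
  refine ⟨integrable_finsetSum _ fun i _ => hint i, ?_⟩
  rw [integral_finsetSum _ fun i _ => hint i]
  simp [integral_mul_const, hmean]

lemma integral_chartHessian {f : M → ℝ} (hf : ContMDiff (𝓡 n) 𝓘(ℝ, ℝ) ∞ f)
    (hφ : φ ∈ charts n M) (hp : p ∈ φ.source) (hae : ∀ᵐ η ∂ν, tangentNorm g p η ≤ K)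
    (hcov : ∀ i j, ∫ η, component φ p η i * component φ p η j ∂ν
      = inverseMetric g φ (φ p) i j) :
    Integrable (fun η => chartHessian g φ f (φ p, chartDeriv φ p η)) ν ∧
      ∫ η, chartHessian g φ f (φ p, chartDeriv φ p η) ∂ν = laplacianInChart g φ f p := by
  simp only [chartHessian_eq_sum g hf hφ (φ.map_source hp), ← component_eq_chartDeriv]
  have hint : ∀ i j, ∀ c : ℝ,
      Integrable (fun η => component φ p η i * component φ p η j * c) ν :=
    fun i j c => (integrable_component_mul g hφ hp hae i j).mul_const c
  refine ⟨integrable_finsetSum _ fun i _ => integrable_finsetSum _ fun j _ => hint i j _, ?_⟩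
  rw [integral_finsetSum _ fun i _ => integrable_finsetSum _ fun j _ => hint i j _]
  unfold laplacianInChart
  refine Finset.sum_congr rfl fun i _ => ?_
  rw [integral_finsetSum _ fun j _ => hint i j _]
  exact Finset.sum_congr rfl fun j _ => by rw [integral_mul_const, hcov]

/-- Compactness bounds `f`. Continuity in `η` is known only on the closed set of bounded velocities,
which suffices for measurability since it has full measure. -/
lemma integrable_geodesicPoint_sub [CompactSpace M] {f : M → ℝ} (hf : Continuous f)
    (hae : ∀ᵐ η ∂ν, tangentNorm g p η ≤ K) {h : ℝ}
    (hcont : ContinuousOn (fun η => f (geodesicPoint g p η h)) {η | tangentNorm g p η ≤ K}) :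
    Integrable (fun η => f (geodesicPoint g p η h) - f p) ν := by
  obtain ⟨B, hB⟩ := isCompact_univ.exists_bound_of_continuousOn hf.continuousOn
  have hD : MeasurableSet {η | tangentNorm g p η ≤ K} :=
    (isClosed_le (continuous_tangentNorm g) continuous_const).measurableSet
  have hmeas : AEStronglyMeasurable (fun η => f (geodesicPoint g p η h)) ν := by
    have h1 := hcont.aestronglyMeasurable (μ := ν) hD
    have h2 : ν.restrict {η | tangentNorm g p η ≤ K} = ν := Measure.restrict_eq_self_of_ae_mem hae
    rwa [h2] at h1
  exact (Integrable.of_bound hmeas B (Eventually.of_forall fun η => hB _ trivial)).sub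
    (integrable_const _)

end Moments

/-- Quantitative convergence at a single point. -/
lemma abs_sq_mul_generator_sub_le [CompactSpace M] {f : M → ℝ}
    (hf : ContMDiff (𝓡 n) 𝓘(ℝ, ℝ) ∞ f) (μ : ∀ p : M, Measure (TangentSpace (𝓡 n) p)) {p : M}
    {K C : ℝ} {C' : NNReal} {N : ℕ} (hN : 0 < N) (hC : 0 ≤ C)
    (hae : ∀ᵐ η ∂(μ p), tangentNorm g p η ≤ K) (hmass : μ p univ ≤ C')
    (hφ : φ ∈ charts n M) (hp : p ∈ φ.source)
    (hmean : ∀ i, ∫ η, component φ p η i ∂(μ p) = 0)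
    (hcov : ∀ i j, ∫ η, component φ p η i * component φ p η j ∂(μ p)
      = inverseMetric g φ (φ p) i j)
    (hcont : ContinuousOn (fun η => f (geodesicPoint g p η (1 / (N : ℝ))))
      {η | tangentNorm g p η ≤ K})
    (hexp : ∀ η : TangentSpace (𝓡 n) p, tangentNorm g p η ≤ K →
      |f (geodesicPoint g p η (1 / (N : ℝ))) - f p
        - (1 / (N : ℝ)) * fderiv ℝ (fun y => f (φ.symm y)) (φ p) (chartDeriv φ p η)
        - (1 / (N : ℝ)) ^ 2 / 2 * chartHessian g φ f (φ p, chartDeriv φ p η)|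
        ≤ C * (1 / (N : ℝ)) ^ 3) :
    |(N : ℝ) ^ 2 * generator g μ N f p - (1 / 2) * laplacianInChart g φ f p| ≤ C * C' / N := by
  have : IsFiniteMeasure (μ p) := ⟨hmass.trans_lt ENNReal.coe_lt_top⟩
  have hN' : (0 : ℝ) < N := by exact_mod_cast hN
  obtain ⟨hA, hA0⟩ := integral_fderiv_chartDeriv g hφ hp hae hmean (fun y => f (φ.symm y))
  obtain ⟨hB, hB0⟩ := integral_chartHessian g hf hφ hp hae hcov
  have hD := integrable_geodesicPoint_sub g hf.continuous hae hcont
  have hrem : ∫ η, (f (geodesicPoint g p η (1 / (N : ℝ))) - f p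
        - (1 / (N : ℝ)) * fderiv ℝ (fun y => f (φ.symm y)) (φ p) (chartDeriv φ p η)
        - (1 / (N : ℝ)) ^ 2 / 2 * chartHessian g φ f (φ p, chartDeriv φ p η)) ∂(μ p) =
      generator g μ N f p - (1 / (N : ℝ)) ^ 2 / 2 * laplacianInChart g φ f p := by
    have h1 := integral_sub (hD.sub (hA.const_mul (1 / (N : ℝ))))
      (hB.const_mul ((1 / (N : ℝ)) ^ 2 / 2))
    have h2 := integral_sub hD (hA.const_mul (1 / (N : ℝ)))
    rw [integral_const_mul, hA0, mul_zero, sub_zero] at h2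
    rw [integral_const_mul, hB0] at h1
    exact h1.trans (congrArg₂ _ h2 rfl)
  have hle := norm_integral_le_of_norm_le_const (μ := μ p) (C := C * (1 / (N : ℝ)) ^ 3)
    (f := fun η => f (geodesicPoint g p η (1 / (N : ℝ))) - f p
        - (1 / (N : ℝ)) * fderiv ℝ (fun y => f (φ.symm y)) (φ p) (chartDeriv φ p η)
        - (1 / (N : ℝ)) ^ 2 / 2 * chartHessian g φ f (φ p, chartDeriv φ p η))
    (hae.mono hexp)
  rw [hrem, Real.norm_eq_abs] at hle
  have hreal : (μ p).real univ ≤ C' := ENNReal.toReal_le_coe_of_le_coe hmass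
  have heq : (N : ℝ) ^ 2 * generator g μ N f p - (1 / 2) * laplacianInChart g φ f p =
      (N : ℝ) ^ 2 * (generator g μ N f p - (1 / (N : ℝ)) ^ 2 / 2 * laplacianInChart g φ f p) := by
    field_simp
  rw [heq, abs_mul, abs_of_pos (by positivity)]
  -- The cubic Taylor error times the total mass, against the factor `N ^ 2`, leaves one power of `1
  -- / N`.
  calc _ ≤ (N : ℝ) ^ 2 * (C * (1 / (N : ℝ)) ^ 3 * C') := by
        refine mul_le_mul_of_nonneg_left (hle.trans ?_) (by positivity)
        exact mul_le_mul_of_nonneg_left hreal (by positivity)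
    _ = C * C' / N := by field_simp

end GeodesicWalk

theorem mainTheorem2 {n : ℕ} {M : Type*} [TopologicalSpace M] [T2Space M] [CompactSpace M]
    [ChartedSpace (EuclideanSpace ℝ (Fin n)) M] [IsManifold (𝓡 n) ∞ M]
    (g : GeodesicWalk.Metric n M)
    (μ : ∀ p : M, Measure (TangentSpace (𝓡 n) p))
    (hsupp : ∃ K : ℝ, ∀ p : M, ∀ η ∈ (μ p).support, GeodesicWalk.tangentNorm g p η ≤ K)
    (hmass : ∃ C : NNReal, ∀ p : M, μ p Set.univ ≤ C)
    (hmean : ∀ p : M, ∀ φ ∈ GeodesicWalk.charts n M, p ∈ φ.source → ∀ i : Fin n,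
      ∫ η, GeodesicWalk.component φ p η i ∂(μ p) = 0)
    (hcov : ∀ p : M, ∀ φ ∈ GeodesicWalk.charts n M, p ∈ φ.source → ∀ i j : Fin n,
      ∫ η, GeodesicWalk.component φ p η i * GeodesicWalk.component φ p η j ∂(μ p)
        = GeodesicWalk.inverseMetric g φ (φ p) i j)
    (f : M → ℝ) (hf : ContMDiff (𝓡 n) 𝓘(ℝ, ℝ) ∞ f) :
    (∀ᶠ N : ℕ in atTop, ∀ p : M, Integrable
      (fun η => f (GeodesicWalk.geodesicPoint g p η (1 / (N : ℝ))) - f p) (μ p)) ∧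
    TendstoUniformly
      (fun (N : ℕ) (p : M) => (N : ℝ) ^ 2 * GeodesicWalk.generator g μ N f p)
      (fun p => (1 / 2) * GeodesicWalk.laplaceBeltrami g f p) atTop := by
  obtain ⟨K, hK⟩ := hsupp
  obtain ⟨C', hC'⟩ := hmass
  have : ∀ p, IsFiniteMeasure (μ p) := fun p => ⟨(hC' p).trans_lt ENNReal.coe_lt_top⟩
  have hae : ∀ p, ∀ᵐ η ∂(μ p), GeodesicWalk.tangentNorm g p η ≤ K := fun p =>
    GeodesicWalk.ae_tangentNorm_le g (hK p)
  obtain ⟨T, hT, C, hC, hexp⟩ := GeodesicWalk.hasUniformExpansion_univ g hf K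
  have hsmall : ∀ᶠ N : ℕ in atTop, 0 < N ∧ 1 / (N : ℝ) ∈ Ioo 0 T := by
    filter_upwards [eventually_gt_atTop 0,
      tendsto_one_div_atTop_nhds_zero_nat.eventually (gt_mem_nhds hT)] with N hN hNT
    exact ⟨hN, by positivity, hNT⟩
  refine ⟨hsmall.mono fun N hN p => GeodesicWalk.integrable_geodesicPoint_sub g hf.continuous
    (hae p) (hexp p trivial _ hN.2).1, ?_⟩
  rw [Metric.tendstoUniformly_iff]
  intro ε hε
  have hlim : Tendsto (fun N : ℕ => C * C' / (N : ℝ)) atTop (𝓝 0) :=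
    tendsto_const_div_atTop_nhds_zero_nat _
  filter_upwards [hsmall, hlim.eventually (gt_mem_nhds hε)] with N hN hNε p
  -- Expansion and moments are read in the preferred chart at `p`, the one defining
  -- `laplaceBeltrami`; the chart varies with `p`, but the bound `C * C' / N` does not.
  have hφ := IsManifold.chart_mem_maximalAtlas (I := 𝓡 n) (n := ∞) p
  have hp := mem_chart_source (EuclideanSpace ℝ (Fin n)) p
  have hE := hexp p trivial _ hN.2
  rw [dist_comm, Real.dist_eq]
  exact (GeodesicWalk.abs_sq_mul_generator_sub_le g hf μ hN.1 hC (hae p) (hC' p) hφ hp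
    (hmean p _ hφ hp) (hcov p _ hφ hp) hE.1 (hE.2 _ hφ hp)).trans_lt hNε
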